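/- Consider type $C_2$: weights are $\nu=(\nu_1,\nu_2)=\nu_1\varpi_1+\nu_2\varpi_2\in X=\mathbb{Z}^2$, the simple roots are $\alpha_1=2\varpi_1-\varpi_2$ (short) and $\alpha_2=-2\varpi_1+2\varpi_2$ (long), $\Phi$ is the root system, $W=\langle s_1,s_2\rangle$ is the Weyl group and $X_+=\mathbb{Z}_{\ge 0}^2$ is the set of dominant weights. For $\mu\in X_+$ and $\nu\in X$ write $\nu\le\mu$ if $\nu\in(\mu+\mathbb{Z}\Phi)\cap\operatorname{Conv}(W\cdot\mu)$. For $\lambda\in X_+$ let $\mathcal{B}(\lambda)$ be the crystal of highest weight $\lambda$, realised on Kashiwara--Nakashima tableaux of shape $(\lambda_1+\lambda_2,\lambda_2)$ in the alphabet $1<2<\bar 2<\bar 1$, with crystal operators $e_i,f_i$, the functions $\varepsilon_i$, and the action of $s_i$ reversing $i$-strings. For $T\in\mathcal{B}(\lambda)$ let $\operatorname{str}_2(T)=(a,b,c,d)$ be the adapted string for the reduced expression $s_2s_1s_2s_1$, i.e. $a=\varepsilon_2(T)$, $b=\varepsilon_1(e_2^aT)$, $c=\varepsilon_2(e_1^be_2^aT)$,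 $d=\varepsilon_1(e_2^ce_1^be_2^aT)$. Let $\Phi:\mathcal{B}(\lambda)\to\mathcal{B}(\lambda+2\varpi_1)$ be the map (denoted by the same letter as the root system) that adds a $1$ at the beginning and a $\bar 1$ at the end of the first row of a tableau and then replaces each column $\begin{smallmatrix}1\\ \bar 1\end{smallmatrix}$ by $\begin{smallmatrix}2\\ \bar 2\end{smallmatrix}$. Put $\mathcal{P}(\lambda)=\mathcal{B}(\lambda)\setminus\Phi(\mathcal{B}(\lambda-2\varpi_1))$ if $\lambda_1\ge 2$ and $\mathcal{P}(\lambda)=\mathcal{B}(\lambda)$ if $\lambda_1\le 1$. A subset $A\subset\mathcal{B}(\lambda)$ is called an atom of highest weight $\mu\in X_+$ if every $\nu\in X$ with $\nu\le\mu$ is the weight of exactly one element of $A$ and no other weight occurs in $A$. In particular its ungraded character $\sum_{T\in A,\ \mathrm{wt}(T)\in X_+}e^{\mathrm{wt}(T)}\in\mathbb{Z}[X_+]$ equals $(\mathbf{N}_\mu)_{v=1}$, the specialization at $v=1$, $\mathbf{H}_\nu\mapsto e^\nu$, of the atomic basis element $\mathbf{N}_\mu=\sum_{\nu\in X_+,\,\nu\le\mu}v^{2\langle\rho^\vee,\mu-\nu\rangle}\mathbf{H}_\nu$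 of the spherical Hecke algebra, with $2\langle\rho^\vee,\nu\rangle=3\nu_1+4\nu_2$. **Proposition.** (1) For every $\lambda\in X_+$ there is a unique map $\bar\Psi:\mathcal{P}(\lambda)\to\mathcal{P}(\lambda+\varpi_2)$ for which there is a map $\Psi:\mathcal{P}(\lambda)\to\mathcal{P}(\lambda+\varpi_2)$ such that, whenever $\operatorname{str}_2(T)=(a,b,c,d)$, $$\operatorname{str}_2(\Psi(T))=\begin{cases}(a,b+1,c+1,d)&\text{if }d=0\text{ or }d=\lambda_1,\\(a,b,c+1,d+1)&\text{otherwise,}\end{cases}$$ and $$\bar\Psi(T)=\begin{cases}\Psi(T)&\text{if }\mathrm{wt}(T)_1\le 0,\\ s_1(\Psi(s_1(T)))&\text{if }\mathrm{wt}(T)_1\ge 0.\end{cases}$$ The set $\mathcal{P}(\lambda)$ is stable under $s_1$, and $\bar\Psi$ is injective, preserves weights and commutes with $s_1$. (2) If $\lambda_1\ne 0$, then $\mathcal{A}(\lambda+\varpi_2):=\mathcal{P}(\lambda+\varpi_2)\setminus\bar\Psi(\mathcal{P}(\lambda))$ is an atom of highest weight $\lambda+\varpi_2$. If $\lambda_1=0$,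 then $\mathcal{A}(\lambda+2\varpi_2):=\mathcal{P}(\lambda+2\varpi_2)\setminus\bar\Psi^2(\mathcal{P}(\lambda))$ is an atom of highest weight $\lambda+2\varpi_2$. In the remaining cases $\lambda_2=0$ and $\lambda=\varpi_2$, the set $\mathcal{A}(\lambda):=\mathcal{P}(\lambda)$ is an atom of highest weight $\lambda$. (3) For every $\lambda\in X_+$, $\mathcal{B}(\lambda)$ has the atomic decomposition $$\mathcal{B}(\lambda)=\bigsqcup_{(k,j)}\Phi^k\bigl(\bar\Psi^j(\mathcal{A}(\lambda-2k\varpi_1-j\varpi_2))\bigr),$$ over all integers $k,j\ge 0$ with $2k\le\lambda_1$, $j\le\lambda_2$, and $j$ even if $2k=\lambda_1$; the piece with index $(k,j)$ is an atom of highest weight $\lambda-2k\varpi_1-j\varpi_2$. -/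

import Mathlib

namespace C2Crystal

/-! ### Letters, words and crystal operators of type `C₂` -/

/-- The alphabet `1 < 2 < 2̄ < 1̄`, coded in this order as `0 < 1 < 2 < 3`. -/
abbrev Letter := Fin 4

abbrev Word := List Letter

/-- The nodes `1`, `2` of the Dynkin diagram (`α₁` is short, `α₂` is long). -/
inductive Node
  | n1
  | n2

/-- Number of `+` labels of a letter: for node 1 the letters `1`, `2̄` carry `+`,
for node 2 the letter `2` carries `+`. -/
def plusLabel : Node → Letter → ℕ
  | .n1, x => if x = 0 ∨ x = 2 then 1 else 0
  | .n2, x => if x = 1 then 1 else 0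

/-- Number of `-` labels of a letter: for node 1 the letters `2`, `1̄` carry `-`,
for node 2 the letter `2̄` carries `-`. -/
def minusLabel : Node → Letter → ℕ
  | .n1, x => if x = 1 ∨ x = 3 then 1 else 0
  | .n2, x => if x = 2 then 1 else 0

/-- `f_i` on letters: `1 → 2` and `2̄ → 1̄` for `i = 1`, `2 → 2̄` for `i = 2`.
Only used on letters with label `+`. -/
def lowerLetter : Node → Letter → Letter
  | .n1, x => if x = 0 then 1 else if x = 2 then 3 else x
  | .n2, x => if x = 1 then 2 else x

/-- `e_i` on letters, inverse to `lowerLetter`. Only used on letters with label `-`. -/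
def raiseLetter : Node → Letter → Letter
  | .n1, x => if x = 1 then 0 else if x = 3 then 2 else x
  | .n2, x => if x = 2 then 1 else x

/-- `ε_i(w)`: the number of `-` left in the `i`-signature `(-)^r (+)^s` of `w`, i.e. after
repeatedly cancelling pairs `+ -` (a `+` to the left of a `-`). -/
def eps (i : Node) : Word → ℕ
  | [] => 0
  | x :: w => minusLabel i x + (eps i w - plusLabel i x)

/-- `φ_i(w)`: the number of `+` left in the `i`-signature `(-)^r (+)^s` of `w`. -/
def phi (i : Node) : Word → ℕ
  | [] => 0
  | x :: w => phi i w + (plusLabel i x - eps i w)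

/-- The operator `f_i`: changes the letter carrying the leftmost `+` of the `i`-signature.
If there is none (`φ_i(w) = 0`, where `f_i` is undefined) the word is left unchanged;
`f_i^k` is only ever applied with `k ≤ φ_i`. -/
def lower (i : Node) : Word → Word
  | [] => []
  | x :: w => if eps i w < plusLabel i x then lowerLetter i x :: w else x :: lower i w

/-- The operator `e_i`: changes the letter carrying the rightmost `-` of the `i`-signature.
If there is none (`ε_i(w) = 0`, where `e_i` is undefined) the word is left unchanged;
`e_i^k` is only ever applied with `k ≤ ε_i`. -/
def raise (i : Node) : Word → Word
  | [] => []
  | x :: w => if plusLabel i x < eps i w then x :: raise i w else raiseLetter i x :: w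

/-- `e_i^{ε_i(w)}(w)`. -/
def raiseMax (i : Node) (w : Word) : Word := (raise i)^[eps i w] w

/-- The action of the simple reflection `s_i`, reversing the `i`-string through `w`. -/
def reflectWord (i : Node) (w : Word) : Word :=
  if phi i w ≤ eps i w then (raise i)^[eps i w - phi i w] w
  else (lower i)^[phi i w - eps i w] w

/-- The weight `(t₁ - t₂, t₂)` in the basis `ϖ₁, ϖ₂`, where `t_i` is the number of letters `i`
minus the number of letters `ī`. -/
def wordWeight (w : Word) : ℤ × ℤ :=
  (((w.count 0 : ℤ) - w.count 3) - ((w.count 1 : ℤ) - w.count 2),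
    (w.count 1 : ℤ) - w.count 2)

/-- The adapted string `(a, b, c, d)` for the reduced expression `s₂s₁s₂s₁`:
`a = ε₂(w)`, `b = ε₁(e₂^a w)`, `c = ε₂(e₁^b e₂^a w)`, `d = ε₁(e₂^c e₁^b e₂^a w)`. -/
def str2Word (w : Word) : ℕ × ℕ × ℕ × ℕ :=
  let w1 := raiseMax .n2 w
  let w2 := raiseMax .n1 w1
  let w3 := raiseMax .n2 w2
  (eps .n2 w, eps .n1 w1, eps .n2 w2, eps .n1 w3)

/-! ### Kashiwara–Nakashima tableaux -/

/-- A filling with (at most) two rows, each listed from left to right. -/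
@[ext]
structure Tableau where
  row1 : List Letter
  row2 : List Letter

namespace Tableau

/-- The columns of height two, from left to right, as pairs (top entry, bottom entry). -/
def columns (T : Tableau) : List (Letter × Letter) := T.row1.zip T.row2

/-- The entries of the columns of height one, from left to right. -/
def singles (T : Tableau) : List Letter := T.row1.drop T.row2.length

/-- The reading word: column by column from the rightmost one, each from top to bottom. -/
def word (T : Tableau) : Word :=
  T.singles.reverse ++ T.columns.reverse.flatMap (fun c => [c.1, c.2])

/-- Rows weakly increasing, columns strictly increasing. -/
def IsSemistandard (T : Tableau) : Prop :=
  T.row1.Pairwise (· ≤ ·) ∧ T.row2.Pairwise (· ≤ ·) ∧ ∀ c ∈ T.columns, c.1 < c.2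

/-- Among the strictly increasing columns of height at most two, only `1 1̄` is not admissible. -/
def Admissible (c : Letter × Letter) : Prop := c ≠ (0, 3)

/-- The left half `lC` of the split of an admissible column: `2 2̄` becomes `1 2̄`. -/
def leftSplit (c : Letter × Letter) : Letter × Letter := if c = (1, 2) then (0, 2) else c

/-- The right half `rC` of the split of an admissible column: `2 2̄` becomes `2 1̄`. -/
def rightSplit (c : Letter × Letter) : Letter × Letter := if c = (1, 2) then (1, 3) else c

/-- The splitting: each column `C` is replaced by the two columns `lC rC`. -/
def split (T : Tableau) : Tableau where
  row1 := T.columns.flatMap (fun c => [(leftSplit c).1, (rightSplit c).1]) ++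
    T.singles.flatMap (fun x => [x, x])
  row2 := T.columns.flatMap (fun c => [(leftSplit c).2, (rightSplit c).2])

/-- `T` is a Kashiwara–Nakashima tableau of shape `λ = l ϖ₁ + m ϖ₂`, i.e. with rows of lengths
`l + m` and `m`. -/
def IsKN (l m : ℕ) (T : Tableau) : Prop :=
  T.row1.length = l + m ∧ T.row2.length = m ∧ T.IsSemistandard ∧
    (∀ c ∈ T.columns, Admissible c) ∧ T.split.IsSemistandard

def weight (T : Tableau) : ℤ × ℤ := wordWeight T.word

def str2 (T : Tableau) : ℕ × ℕ × ℕ × ℕ := str2Word T.word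

/-- `S = s₁(T)`: the tableau `S` has the shape of `T`, and its word is obtained from that
of `T` by the action of `s₁`. -/
def IsReflection1 (T S : Tableau) : Prop :=
  S.row1.length = T.row1.length ∧ S.row2.length = T.row2.length ∧
    S.word = reflectWord .n1 T.word

/-- Put `1` in front of the first row and `1̄` at its end. -/
def Phi' (T : Tableau) : Tableau where
  row1 := 0 :: (T.row1 ++ [3])
  row2 := T.row2

/-- The embedding `Φ : B(λ) → B(λ + 2ϖ₁)`: in `Phi' T`, a column `1 1̄` is replaced by `2 2̄`. -/
def Phi (T : Tableau) : Tableau :=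
  let cols := T.Phi'.columns.map (fun c => if c = (0, 3) then (1, 2) else c)
  { row1 := cols.map Prod.fst ++ T.Phi'.singles
    row2 := cols.map Prod.snd }

end Tableau

/-- The crystal `B(l ϖ₁ + m ϖ₂)`, realised on Kashiwara–Nakashima tableaux. -/
def crystal (l m : ℕ) : Set Tableau := {T | T.IsKN l m}

/-- The principal preatom `P(l ϖ₁ + m ϖ₂)`. -/
def preatom : ℕ → ℕ → Set Tableau
  | 0, m => crystal 0 m
  | 1, m => crystal 1 m
  | l + 2, m => crystal (l + 2) m \ Tableau.Phi '' crystal l m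

/-! ### Weights, the order, atoms -/

/-- The simple reflections on the weight lattice, in the basis `ϖ₁, ϖ₂`; here
`α₁ = 2ϖ₁ - ϖ₂` and `α₂ = -2ϖ₁ + 2ϖ₂`. -/
def reflectWeight : Node → ℤ × ℤ → ℤ × ℤ
  | .n1, ν => ν - ν.1 • ((2, -1) : ℤ × ℤ)
  | .n2, ν => ν - ν.2 • ((-2, 2) : ℤ × ℤ)

/-- The orbit of a weight under the Weyl group `W = ⟨s₁, s₂⟩`. -/
def weylOrbit (ν : ℤ × ℤ) : Set (ℤ × ℤ) :=
  {μ | ∃ is : List Node, μ = is.foldr reflectWeight ν}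

def rootLattice : AddSubgroup (ℤ × ℤ) :=
  AddSubgroup.closure {((2, -1) : ℤ × ℤ), ((-2, 2) : ℤ × ℤ)}

def toReal (ν : ℤ × ℤ) : ℝ × ℝ := ((ν.1 : ℝ), (ν.2 : ℝ))

/-- `ν ≤ μ` for a dominant weight `μ`: `ν ∈ (μ + ℤΦ) ∩ Conv(W · μ)`. -/
def WeightLE (ν μ : ℤ × ℤ) : Prop :=
  ν - μ ∈ rootLattice ∧ toReal ν ∈ convexHull ℝ (toReal '' weylOrbit μ)

/-- The dominant weights `X₊`, in the basis `ϖ₁, ϖ₂`. -/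
abbrev DominantWeight := ℕ × ℕ

def DominantWeight.toWeight (μ : DominantWeight) : ℤ × ℤ := ((μ.1 : ℤ), (μ.2 : ℤ))

/-- The spherical Hecke algebra as a `ℤ[v, v⁻¹]`-module, free on the standard basis
`(H_μ)` indexed by dominant weights. -/
abbrev SphericalHecke := DominantWeight →₀ LaurentPolynomial ℤ

/-- The atomic basis element `N_μ = ∑_{ν ≤ μ} v^{2⟨ρ^∨, μ - ν⟩} H_ν` (`ν` dominant);
note that `2⟨ρ^∨, (x, y)⟩ = 3x + 4y`. -/
noncomputable def atomicBasis (μ : DominantWeight) : SphericalHecke :=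
  ∑ᶠ ν ∈ {ν : DominantWeight | WeightLE ν.toWeight μ.toWeight},
    Finsupp.single ν (LaurentPolynomial.T
      (3 * ((μ.1 : ℤ) - (ν.1 : ℤ)) + 4 * ((μ.2 : ℤ) - (ν.2 : ℤ))))

/-- The specialization `v = 1`, with values in `ℤ[X₊]` (with basis `e^μ = single μ 1`). -/
noncomputable def specializeOne (h : SphericalHecke) : DominantWeight →₀ ℤ :=
  h.mapRange (LaurentPolynomial.eval₂ (RingHom.id ℤ) (1 : ℤˣ)) (map_zero _)

/-- The ungraded character `∑ e^{wt(T)}`, over the elements `T` of `A` of dominant weight. -/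
noncomputable def ungradedCharacter (A : Set Tableau) : DominantWeight →₀ ℤ :=
  ∑ᶠ T ∈ {T : Tableau | T ∈ A ∧ 0 ≤ T.weight.1 ∧ 0 ≤ T.weight.2},
    Finsupp.single (T.weight.1.toNat, T.weight.2.toNat) 1

/-- `A` is an atom of highest weight `μ`: its ungraded character is `(N_μ)_{v=1}`, every weight
`≤ μ` is the weight of exactly one element of `A`, and no other weight occurs in `A`. -/
structure IsAtom (A : Set Tableau) (μ : DominantWeight) : Prop where
  character : ungradedCharacter A = specializeOne (atomicBasis μ)
  occursOnce : ∀ ν : ℤ × ℤ, WeightLE ν μ.toWeight → ∃! T : Tableau, T ∈ A ∧ T.weight = ν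
  onlyBelow : ∀ T ∈ A, WeightLE T.weight μ.toWeight

/-! ### The maps `Ψ` and `Ψ̄` -/

/-- The map `Ψ : P(λ) → P(λ + ϖ₂)` in terms of adapted strings, for `λ = l ϖ₁ + m ϖ₂`. -/
def IsPsi {l m : ℕ} (Ψ : preatom l m → preatom l (m + 1)) : Prop :=
  ∀ (T : preatom l m) (a b c d : ℕ), T.1.str2 = (a, b, c, d) →
    (Ψ T).1.str2 = if d = 0 ∨ d = l then (a, b + 1, c + 1, d) else (a, b, c + 1, d + 1)

/-- The map `Ψ̄ : P(λ) → P(λ + ϖ₂)`, with `Ψ̄(T) = Ψ(T)` if `wt(T)₁ ≤ 0` and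
`Ψ̄(T) = s₁(Ψ(s₁(T)))` if `wt(T)₁ ≥ 0`. -/
def IsPsiBar {l m : ℕ} (Ψbar : preatom l m → preatom l (m + 1)) : Prop :=
  ∃ Ψ : preatom l m → preatom l (m + 1), IsPsi Ψ ∧
    (∀ T : preatom l m, T.1.weight.1 ≤ 0 → Ψbar T = Ψ T) ∧
    (∀ T : preatom l m, 0 ≤ T.1.weight.1 → ∃ S : preatom l m,
      T.1.IsReflection1 S.1 ∧ (Ψ S).1.IsReflection1 (Ψbar T).1)

/-- A family of maps `P(λ) → P(λ + ϖ₂)`, one for each dominant `λ = l ϖ₁ + m ϖ₂`. -/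
abbrev PreatomMaps := ∀ l m : ℕ, preatom l m → preatom l (m + 1)

/-- The power `Ψ̄^j : P(l ϖ₁ + m ϖ₂) → P(l ϖ₁ + (m + j) ϖ₂)`. -/
def iteratePsi (Ψbar : PreatomMaps) (l m : ℕ) : (j : ℕ) → preatom l m → preatom l (m + j)
  | 0, T => T
  | j + 1, T => Ψbar l (m + j) (iteratePsi Ψbar l m j T)

/-- The set `A(λ) ⊆ P(λ)`: it is `P(λ)` if `λ₂ = 0` or `λ = ϖ₂`, and otherwise the complement of
the image of `Ψ̄` (if `λ₁ > 0`) or of `Ψ̄²` (if `λ₁ = 0`). -/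
def principalAtom (Ψbar : PreatomMaps) : (l m : ℕ) → Set (preatom l m)
  | _, 0 => Set.univ
  | 0, 1 => Set.univ
  | 0, m + 2 => (Set.range (iteratePsi Ψbar 0 m 2))ᶜ
  | l + 1, m + 1 => (Set.range (Ψbar (l + 1) m))ᶜ

/-- The indices of the atoms in `B(l ϖ₁ + m ϖ₂)`: quadruples `(l', m', k, j)` with
`l = l' + 2k` and `m = m' + j`, where `j` is even if `l' = 0`. -/
def atomIndex (l m : ℕ) : Set (ℕ × ℕ × ℕ × ℕ) :=
  {p | p.1 + 2 * p.2.2.1 = l ∧ p.2.1 + p.2.2.2 = m ∧ (p.1 = 0 → Even p.2.2.2)}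

/-- The piece `Φ^k(Ψ̄^j(A(l' ϖ₁ + m' ϖ₂)))` with index `(l', m', k, j)`. -/
def atomPiece (Ψbar : PreatomMaps) (p : ℕ × ℕ × ℕ × ℕ) : Set Tableau :=
  (fun T : preatom p.1 p.2.1 =>
    Tableau.Phi^[p.2.2.1] (iteratePsi Ψbar p.1 p.2.1 p.2.2.2 T).1) ''
      principalAtom Ψbar p.1 p.2.1

end C2Crystal

namespace C2Crystal

/-! ### Signatures of concatenations -/

/-! Everything is moved to integer coordinates adapted to node 1. A Kashiwara–Nakashima tableau is a
list of blocks of equal columns, and as a crystal for node 1, `B(λ)` is a disjoint union of tensor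
products of two strings, of lengths `R` and `N = Q + 2K`, with positions `r` and `x`; the columns `1
2` and `2̄ 1̄` (counted by `A`, `E`) are inert (`exists_tableau_eq`, `eps1_word`). In these
coordinates the adapted string has a closed formula (`str2Word_word`) and determines the point for a
given shape (`eq_of_str2_eq`); hence `Ψ` and `Ψ̄` are unique if they exist.

The 1-strings of one component are indexed by `min r x`. The complement of the image of `Φ` consists
of the ends of all 1-strings, the whole shortest one and, if `Q = 0`, the whole longest one. The
explicit map `psiBar` sends ends of strings to ends of strings of the same length in a neighbouring
component and pushes the remaining strings into the interior of strings two steps longer. This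
explains injectivity, preservation of weights and commutation with `s₁`; it agrees with `psi` on
weights with first coordinate at most 0, so it is `Ψ̄`.

For the atoms, `WeightLE` is rewritten as a congruence and eight inequalities (`weightLE_iff`). The
quantity `ν₁ + 2ν₂ = Q - R + 2A - 2E` is constant along 1-strings, and on each line where it is
fixed the points outside the image of `Ψ̄` meet every weight of the octagon exactly once
(`exists_atomic`, `Atomic.eq_of_weight_eq`). For `l = 0` a weight fixes the parity of `K`, so `Ψ̄²`
replaces `Ψ̄`.

The decomposition then follows by removing `Φ` and then `Ψ̄` (or `Ψ̄²`) as often as possible: both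
are injective and preserve weights, so every piece has the weights of its principal atom. -/

theorem eps_append (i : Node) (u v : Word) :
    eps i (u ++ v) = eps i u + (eps i v - phi i u) := by
  induction u with
  | nil => simp [eps, phi]
  | cons x u ih => simp only [List.cons_append, eps, phi, ih]; omega

theorem phi_append (i : Node) (u v : Word) :
    phi i (u ++ v) = phi i v + (phi i u - eps i v) := by
  induction u with
  | nil => simp [phi]
  | cons x u ih => simp only [List.cons_append, phi, ih, eps_append]; omega

theorem raise_of_eps_eq_zero (i : Node) (u : Word) (h : eps i u = 0) : raise i u = u := by
  cases u with
  | nil => rfl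
  | cons x u =>
    simp only [eps] at h
    have h1 : minusLabel i x = 0 := by omega
    have h2 : ¬ plusLabel i x < eps i u := by omega
    simp only [raise, if_neg h2]
    congr 1
    clear h h2
    revert h1
    cases i <;> revert x <;> decide

theorem raise_append_right (i : Node) (u v : Word) (h : phi i u < eps i v) :
    raise i (u ++ v) = u ++ raise i v := by
  induction u with
  | nil => rfl
  | cons x u ih =>
    simp only [phi] at h
    have : plusLabel i x < eps i (u ++ v) := by rw [eps_append]; omega
    simp only [List.cons_append, raise, if_pos this]
    rw [ih (by omega)]

theorem raise_append_left (i : Node) (u v : Word) (h : eps i v ≤ phi i u) :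
    raise i (u ++ v) = raise i u ++ v := by
  induction u with
  | nil =>
    simp only [phi] at h
    simp only [List.nil_append, raise]
    exact raise_of_eps_eq_zero i v (by omega)
  | cons x u ih =>
    simp only [phi] at h
    simp only [List.cons_append, raise, eps_append]
    by_cases h1 : plusLabel i x < eps i u
    · have h2 : plusLabel i x < eps i u + (eps i v - phi i u) := by omega
      rw [if_pos h1, if_pos h2, ih (by omega)]; rfl
    · have h2 : ¬ plusLabel i x < eps i u + (eps i v - phi i u) := by omega
      rw [if_neg h1, if_neg h2]; rfl

theorem lower_append_left (i : Node) (u v : Word) (h : eps i v < phi i u) :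
    lower i (u ++ v) = lower i u ++ v := by
  induction u with
  | nil => simp [phi] at h
  | cons x u ih =>
    simp only [phi] at h
    simp only [List.cons_append, lower, eps_append]
    by_cases h1 : eps i u < plusLabel i x
    · by_cases h2 : eps i u + (eps i v - phi i u) < plusLabel i x
      · rw [if_pos h1, if_pos h2]; rfl
      · omega
    · have h2 : ¬ eps i u + (eps i v - phi i u) < plusLabel i x := by omega
      rw [if_neg h1, if_neg h2, ih (by omega)]; rfl

theorem lower_append_right (i : Node) (u v : Word) (h : phi i u ≤ eps i v) :
    lower i (u ++ v) = u ++ lower i v := by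
  induction u with
  | nil => rfl
  | cons x u ih =>
    simp only [phi] at h
    have : ¬ eps i (u ++ v) < plusLabel i x := by rw [eps_append]; omega
    simp only [List.cons_append, lower, if_neg this]
    rw [ih (by omega)]

/-- The hypotheses place the rightmost surviving `-` in the middle factor: its pluses absorb every
`-` to the right, and one of its own `-` escapes the pluses to the left. -/
theorem raise_append_append (i : Node) (u v w : Word) (h : eps i w ≤ phi i v)
    (h' : phi i u < eps i v) : raise i (u ++ (v ++ w)) = u ++ (raise i v ++ w) := by
  rw [raise_append_right i u (v ++ w) (by rw [eps_append]; omega), raise_append_left i v w h]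

theorem lower_append_append (i : Node) (u v w : Word) (h : eps i w < phi i v)
    (h' : phi i u ≤ eps i v) : lower i (u ++ (v ++ w)) = u ++ (lower i v ++ w) := by
  rw [lower_append_right i u (v ++ w) (by rw [eps_append]; omega), lower_append_left i v w h]

/-! ### Words made of blocks -/

/-- The word `w` repeated `n` times. -/
def rep (n : ℕ) (w : Word) : Word := (List.replicate n w).flatten

theorem rep_zero (w : Word) : rep 0 w = [] := rfl

theorem rep_succ (n : ℕ) (w : Word) : rep (n + 1) w = w ++ rep n w := by
  simp [rep, List.replicate_succ]

theorem rep_succ' (n : ℕ) (w : Word) : rep (n + 1) w = rep n w ++ w := by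
  simp [rep, List.replicate_succ']

theorem eps_rep_of_phi (i : Node) (n : ℕ) (w : Word) {k : ℕ} (hk : eps i w = k)
    (h : phi i w = 0) : eps i (rep n w) = n * k ∧ phi i (rep n w) = 0 := by
  induction n with
  | zero => simp [rep, eps, phi]
  | succ n ih => rw [rep_succ, eps_append, phi_append, ih.1, ih.2, h, hk, add_one_mul]; omega

theorem phi_rep_of_eps (i : Node) (n : ℕ) (w : Word) {k : ℕ} (hk : phi i w = k)
    (h : eps i w = 0) : eps i (rep n w) = 0 ∧ phi i (rep n w) = n * k := by
  induction n with
  | zero => simp [rep, eps, phi]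
  | succ n ih => rw [rep_succ, eps_append, phi_append, ih.1, ih.2, h, hk, add_one_mul]; omega

/-- `φ_i - ε_i`, which is additive in the word. -/
def excess (i : Node) (w : Word) : ℤ := phi i w - eps i w

theorem excess_append (i : Node) (u v : Word) :
    excess i (u ++ v) = excess i u + excess i v := by
  simp only [excess, eps_append, phi_append]; omega

/-- The reading word of the tableau with `A`, `B`, `C`, `D`, `E` columns
`1 2`, `1 2̄`, `2 2̄`, `2 1̄`, `2̄ 1̄` and `p`, `q`, `r`, `s` columns `1`, `2`, `2̄`, `1̄`. -/
def blockWord (A B C D E p q r s : ℕ) : Word :=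
  rep s [3] ++ (rep r [2] ++ (rep q [1] ++ (rep p [0] ++ (rep E [2, 3] ++ (rep D [1, 3] ++
    (rep C [1, 2] ++ (rep B [0, 2] ++ rep A [0, 1])))))))

section blocks

variable (n : ℕ)

theorem sig1_0 : eps .n1 (rep n [0]) = 0 ∧ phi .n1 (rep n [0]) = n := by
  simpa using phi_rep_of_eps (k := 1) .n1 n [0] rfl rfl
theorem sig1_1 : eps .n1 (rep n [1]) = n ∧ phi .n1 (rep n [1]) = 0 := by
  simpa using eps_rep_of_phi (k := 1) .n1 n [1] rfl rfl
theorem sig1_2 : eps .n1 (rep n [2]) = 0 ∧ phi .n1 (rep n [2]) = n := by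
  simpa using phi_rep_of_eps (k := 1) .n1 n [2] rfl rfl
theorem sig1_3 : eps .n1 (rep n [3]) = n ∧ phi .n1 (rep n [3]) = 0 := by
  simpa using eps_rep_of_phi (k := 1) .n1 n [3] rfl rfl
theorem sig1_01 : eps .n1 (rep n [0, 1]) = 0 ∧ phi .n1 (rep n [0, 1]) = 0 := by
  simpa using eps_rep_of_phi (k := 0) .n1 n [0, 1] rfl rfl
theorem sig1_02 : eps .n1 (rep n [0, 2]) = 0 ∧ phi .n1 (rep n [0, 2]) = n * 2 := by
  simpa using phi_rep_of_eps (k := 2) .n1 n [0, 2] rfl rfl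
theorem sig1_13 : eps .n1 (rep n [1, 3]) = n * 2 ∧ phi .n1 (rep n [1, 3]) = 0 := by
  simpa using eps_rep_of_phi (k := 2) .n1 n [1, 3] rfl rfl
theorem sig1_23 : eps .n1 (rep n [2, 3]) = 0 ∧ phi .n1 (rep n [2, 3]) = 0 := by
  simpa using eps_rep_of_phi (k := 0) .n1 n [2, 3] rfl rfl
theorem sig2_0 : eps .n2 (rep n [0]) = 0 ∧ phi .n2 (rep n [0]) = 0 := by
  simpa using phi_rep_of_eps (k := 0) .n2 n [0] rfl rfl
theorem sig2_1 : eps .n2 (rep n [1]) = 0 ∧ phi .n2 (rep n [1]) = n := by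
  simpa using phi_rep_of_eps (k := 1) .n2 n [1] rfl rfl
theorem sig2_2 : eps .n2 (rep n [2]) = n ∧ phi .n2 (rep n [2]) = 0 := by
  simpa using eps_rep_of_phi (k := 1) .n2 n [2] rfl rfl
theorem sig2_3 : eps .n2 (rep n [3]) = 0 ∧ phi .n2 (rep n [3]) = 0 := by
  simpa using phi_rep_of_eps (k := 0) .n2 n [3] rfl rfl
theorem sig2_01 : eps .n2 (rep n [0, 1]) = 0 ∧ phi .n2 (rep n [0, 1]) = n := by
  simpa using phi_rep_of_eps (k := 1) .n2 n [0, 1] rfl rfl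
theorem sig2_02 : eps .n2 (rep n [0, 2]) = n ∧ phi .n2 (rep n [0, 2]) = 0 := by
  simpa using eps_rep_of_phi (k := 1) .n2 n [0, 2] rfl rfl
theorem sig2_12 : eps .n2 (rep n [1, 2]) = 0 ∧ phi .n2 (rep n [1, 2]) = 0 := by
  simpa using eps_rep_of_phi (k := 0) .n2 n [1, 2] rfl rfl
theorem sig2_13 : eps .n2 (rep n [1, 3]) = 0 ∧ phi .n2 (rep n [1, 3]) = n := by
  simpa using phi_rep_of_eps (k := 1) .n2 n [1, 3] rfl rfl
theorem sig2_23 : eps .n2 (rep n [2, 3]) = n ∧ phi .n2 (rep n [2, 3]) = 0 := by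
  simpa using eps_rep_of_phi (k := 1) .n2 n [2, 3] rfl rfl

end blocks

/-- Neighbouring columns `2 2̄` cancel against each other, so their signature does not grow with
their number; the bound, which holds in Kashiwara–Nakashima tableaux, is essential. -/
theorem sig1_12 (C : ℕ) (hC : C ≤ 1) :
    eps .n1 (rep C [1, 2]) = C ∧ phi .n1 (rep C [1, 2]) = C := by
  interval_cases C <;> decide

theorem eps1_blockWord (A B C D E p q r s : ℕ) (hC : C ≤ 1) :
    eps .n1 (blockWord A B C D E p q r s) = s + (q + (2 * D + C - p) - r) := by
  simp only [blockWord, eps_append, sig1_0, sig1_1, sig1_2, sig1_3, sig1_01, sig1_02,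
    sig1_12 C hC, sig1_13, sig1_23]
  omega

/-- `φ - ε` is additive, hence a plain count of letters; the equation is arranged so that no
subtraction occurs. -/
theorem phi1_blockWord (A B C D E p q r s : ℕ) (hC : C ≤ 1) :
    phi .n1 (blockWord A B C D E p q r s) + s + q + 2 * D =
      eps .n1 (blockWord A B C D E p q r s) + 2 * B + p + r := by
  have h : excess .n1 (blockWord A B C D E p q r s) = -s + r - q + p - 2 * D + 2 * B := by
    simp only [blockWord, excess_append]
    simp only [excess, sig1_0, sig1_1, sig1_2, sig1_3, sig1_01, sig1_02, sig1_12 C hC, sig1_13,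
      sig1_23]
    omega
  unfold excess at h
  omega

theorem eps2_blockWord (A B C D E p q r s : ℕ) :
    eps .n2 (blockWord A B C D E p q r s) = r + (E + (B - D) - q) := by
  simp only [blockWord, eps_append, sig2_0, sig2_1, sig2_2, sig2_3, sig2_01, sig2_02,
    sig2_12, sig2_13, sig2_23]
  omega

set_option linter.unusedSimpArgs false

/-! ### Single steps of the crystal operators on block words. -/

theorem raise2_blockWord_B (A B C D E p q r s : ℕ) (h : D + (q - E) ≤ B) :
    raise .n2 (blockWord A (B + 1) C D E p q r s) =
      blockWord (A + 1) B C D E p q r s := by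
  have h1 : blockWord A (B + 1) C D E p q r s =
      (rep s [3] ++ (rep r [2] ++ (rep q [1] ++ (rep p [0] ++ (rep E [2, 3] ++ (rep D [1, 3] ++
        (rep C [1, 2] ++ (rep B [0, 2])))))))) ++ ([0, 2] ++ (rep A [0, 1])) := by
    simp [blockWord, rep_zero, rep_succ']
  have h2 : blockWord (A + 1) B C D E p q r s =
      (rep s [3] ++ (rep r [2] ++ (rep q [1] ++ (rep p [0] ++ (rep E [2, 3] ++ (rep D [1, 3] ++
        (rep C [1, 2] ++ (rep B [0, 2])))))))) ++ ([0, 1] ++ (rep A [0, 1])) := by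
    simp [blockWord, rep_zero, rep_succ]
  have h3 : raise .n2 [0, 2] = [0, 1] := by decide
  have h4 : eps .n2 [0, 2] = 1 := by decide
  have h5 : phi .n2 [0, 2] = 0 := by decide
  rw [h1, h2, raise_append_append, h3]
  all_goals
    simp only [h4, h5, eps_append, phi_append, sig2_0, sig2_1, sig2_2, sig2_3, sig2_01, sig2_02,
      sig2_12, sig2_13, sig2_23]
    omega

theorem raise2_blockWord_E (A B C D E p q r s : ℕ) (h : q ≤ E) (h' : B ≤ D) :
    raise .n2 (blockWord A B C D (E + 1) p q r s) =
      blockWord A B C (D + 1) E p q r s := by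
  have h1 : blockWord A B C D (E + 1) p q r s =
      (rep s [3] ++ (rep r [2] ++ (rep q [1] ++ (rep p [0] ++ (rep E [2, 3]))))) ++ ([2, 3] ++
        (rep D [1, 3] ++ (rep C [1, 2] ++ (rep B [0, 2] ++ (rep A [0, 1]))))) := by
    simp [blockWord, rep_zero, rep_succ']
  have h2 : blockWord A B C (D + 1) E p q r s =
      (rep s [3] ++ (rep r [2] ++ (rep q [1] ++ (rep p [0] ++ (rep E [2, 3]))))) ++ ([1, 3] ++
        (rep D [1, 3] ++ (rep C [1, 2] ++ (rep B [0, 2] ++ (rep A [0, 1]))))) := by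
    simp [blockWord, rep_zero, rep_succ]
  have h3 : raise .n2 [2, 3] = [1, 3] := by decide
  have h4 : eps .n2 [2, 3] = 1 := by decide
  have h5 : phi .n2 [2, 3] = 0 := by decide
  rw [h1, h2, raise_append_append, h3]
  all_goals
    simp only [h4, h5, eps_append, phi_append, sig2_0, sig2_1, sig2_2, sig2_3, sig2_01, sig2_02,
      sig2_12, sig2_13, sig2_23]
    omega

theorem raise2_blockWord_r (A B C D E p q r s : ℕ) (h : E + (B - D) ≤ q) :
    raise .n2 (blockWord A B C D E p q (r + 1) s) =
      blockWord A B C D E p (q + 1) r s := by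
  have h1 : blockWord A B C D E p q (r + 1) s =
      (rep s [3] ++ (rep r [2])) ++ ([2] ++ (rep q [1] ++ (rep p [0] ++ (rep E [2, 3] ++
        (rep D [1, 3] ++ (rep C [1, 2] ++ (rep B [0, 2] ++ (rep A [0, 1])))))))) := by
    simp [blockWord, rep_zero, rep_succ']
  have h2 : blockWord A B C D E p (q + 1) r s =
      (rep s [3] ++ (rep r [2])) ++ ([1] ++ (rep q [1] ++ (rep p [0] ++ (rep E [2, 3] ++
        (rep D [1, 3] ++ (rep C [1, 2] ++ (rep B [0, 2] ++ (rep A [0, 1])))))))) := by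
    simp [blockWord, rep_zero, rep_succ]
  have h3 : raise .n2 [2] = [1] := by decide
  have h4 : eps .n2 [2] = 1 := by decide
  have h5 : phi .n2 [2] = 0 := by decide
  rw [h1, h2, raise_append_append, h3]
  all_goals
    simp only [h4, h5, eps_append, phi_append, sig2_0, sig2_1, sig2_2, sig2_3, sig2_01, sig2_02,
      sig2_12, sig2_13, sig2_23]
    omega

theorem raise1_blockWord_s (A B C D E p q r s : ℕ) (hC : C ≤ 1) (h : q + (2 * D + C - p) ≤ r) :
    raise .n1 (blockWord A B C D E p q r (s + 1)) =
      blockWord A B C D E p q (r + 1) s := by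
  have h1 : blockWord A B C D E p q r (s + 1) =
      (rep s [3]) ++ ([3] ++ (rep r [2] ++ (rep q [1] ++ (rep p [0] ++ (rep E [2, 3] ++
        (rep D [1, 3] ++ (rep C [1, 2] ++ (rep B [0, 2] ++ (rep A [0, 1]))))))))) := by
    simp [blockWord, rep_zero, rep_succ']
  have h2 : blockWord A B C D E p q (r + 1) s =
      (rep s [3]) ++ ([2] ++ (rep r [2] ++ (rep q [1] ++ (rep p [0] ++ (rep E [2, 3] ++
        (rep D [1, 3] ++ (rep C [1, 2] ++ (rep B [0, 2] ++ (rep A [0, 1]))))))))) := by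
    simp [blockWord, rep_zero, rep_succ]
  have h3 : raise .n1 [3] = [2] := by decide
  have h4 : eps .n1 [3] = 1 := by decide
  have h5 : phi .n1 [3] = 0 := by decide
  rw [h1, h2, raise_append_append, h3]
  all_goals
    simp only [h4, h5, eps_append, phi_append, sig1_0, sig1_1, sig1_2, sig1_3, sig1_01, sig1_02, sig1_13,
      sig1_23, sig1_12 C hC]
    omega

theorem raise1_blockWord_q (A B C D E p q r s : ℕ) (hC : C ≤ 1) (h : 2 * D + C ≤ p) (h' : r ≤ q) :
    raise .n1 (blockWord A B C D E p (q + 1) r s) =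
      blockWord A B C D E (p + 1) q r s := by
  have h1 : blockWord A B C D E p (q + 1) r s =
      (rep s [3] ++ (rep r [2] ++ (rep q [1]))) ++ ([1] ++ (rep p [0] ++ (rep E [2, 3] ++
        (rep D [1, 3] ++ (rep C [1, 2] ++ (rep B [0, 2] ++ (rep A [0, 1]))))))) := by
    simp [blockWord, rep_zero, rep_succ']
  have h2 : blockWord A B C D E (p + 1) q r s =
      (rep s [3] ++ (rep r [2] ++ (rep q [1]))) ++ ([0] ++ (rep p [0] ++ (rep E [2, 3] ++
        (rep D [1, 3] ++ (rep C [1, 2] ++ (rep B [0, 2] ++ (rep A [0, 1]))))))) := by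
    simp [blockWord, rep_zero, rep_succ]
  have h3 : raise .n1 [1] = [0] := by decide
  have h4 : eps .n1 [1] = 1 := by decide
  have h5 : phi .n1 [1] = 0 := by decide
  rw [h1, h2, raise_append_append, h3]
  all_goals
    simp only [h4, h5, eps_append, phi_append, sig1_0, sig1_1, sig1_2, sig1_3, sig1_01, sig1_02, sig1_13,
      sig1_23, sig1_12 C hC]
    omega

theorem raise1_blockWord_C (A B D E q r s : ℕ) (h : r ≤ q + 2 * D) :
    raise .n1 (blockWord A B 1 D E 0 q r s) =
      blockWord A (B + 1) 0 D E 0 q r s := by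
  have h1 : blockWord A B 1 D E 0 q r s =
      (rep s [3] ++ (rep r [2] ++ (rep q [1] ++ (rep E [2, 3] ++ (rep D [1, 3]))))) ++
        ([1, 2] ++ (rep B [0, 2] ++ (rep A [0, 1]))) := by
    simp [blockWord, rep_zero, rep_succ']
  have h2 : blockWord A (B + 1) 0 D E 0 q r s =
      (rep s [3] ++ (rep r [2] ++ (rep q [1] ++ (rep E [2, 3] ++ (rep D [1, 3]))))) ++
        ([0, 2] ++ (rep B [0, 2] ++ (rep A [0, 1]))) := by
    simp [blockWord, rep_zero, rep_succ]
  have h3 : raise .n1 [1, 2] = [0, 2] := by decide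
  have h4 : eps .n1 [1, 2] = 1 := by decide
  have h5 : phi .n1 [1, 2] = 1 := by decide
  rw [h1, h2, raise_append_append, h3]
  all_goals
    simp only [h4, h5, eps_append, phi_append, sig1_0, sig1_1, sig1_2, sig1_3, sig1_01, sig1_02, sig1_13,
      sig1_23]
    omega

theorem raise1_blockWord_D (A B D E q r s : ℕ) (h : r ≤ q + 2 * D + 1) :
    raise .n1 (blockWord A B 0 (D + 1) E 0 q r s) =
      blockWord A B 1 D E 0 q r s := by
  have h1 : blockWord A B 0 (D + 1) E 0 q r s =
      (rep s [3] ++ (rep r [2] ++ (rep q [1] ++ (rep E [2, 3] ++ (rep D [1, 3]))))) ++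
        ([1, 3] ++ (rep B [0, 2] ++ (rep A [0, 1]))) := by
    simp [blockWord, rep_zero, rep_succ']
  have h2 : blockWord A B 1 D E 0 q r s =
      (rep s [3] ++ (rep r [2] ++ (rep q [1] ++ (rep E [2, 3] ++ (rep D [1, 3]))))) ++
        ([1, 2] ++ (rep B [0, 2] ++ (rep A [0, 1]))) := by
    simp [blockWord, rep_zero, rep_succ]
  have h3 : raise .n1 [1, 3] = [1, 2] := by decide
  have h4 : eps .n1 [1, 3] = 2 := by decide
  have h5 : phi .n1 [1, 3] = 0 := by decide
  rw [h1, h2, raise_append_append, h3]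
  all_goals
    simp only [h4, h5, eps_append, phi_append, sig1_0, sig1_1, sig1_2, sig1_3, sig1_01, sig1_02, sig1_13,
      sig1_23]
    omega

theorem lower1_blockWord_r (A B C D E p q r s : ℕ) (hC : C ≤ 1) (h : q + (2 * D + C - p) ≤ r) :
    lower .n1 (blockWord A B C D E p q (r + 1) s) =
      blockWord A B C D E p q r (s + 1) := by
  have h1 : blockWord A B C D E p q (r + 1) s =
      (rep s [3]) ++ ([2] ++ (rep r [2] ++ (rep q [1] ++ (rep p [0] ++ (rep E [2, 3] ++
        (rep D [1, 3] ++ (rep C [1, 2] ++ (rep B [0, 2] ++ (rep A [0, 1]))))))))) := by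
    simp [blockWord, rep_zero, rep_succ]
  have h2 : blockWord A B C D E p q r (s + 1) =
      (rep s [3]) ++ ([3] ++ (rep r [2] ++ (rep q [1] ++ (rep p [0] ++ (rep E [2, 3] ++
        (rep D [1, 3] ++ (rep C [1, 2] ++ (rep B [0, 2] ++ (rep A [0, 1]))))))))) := by
    simp [blockWord, rep_zero, rep_succ']
  have h3 : lower .n1 [2] = [3] := by decide
  have h4 : eps .n1 [2] = 0 := by decide
  have h5 : phi .n1 [2] = 1 := by decide
  rw [h1, h2, lower_append_append, h3]
  all_goals
    simp only [h4, h5, eps_append, phi_append, sig1_0, sig1_1, sig1_2, sig1_3, sig1_01, sig1_02, sig1_13,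
      sig1_23, sig1_12 C hC]
    omega

theorem lower1_blockWord_p (A B E p q r s : ℕ) (h : r ≤ q) :
    lower .n1 (blockWord A B 0 0 E (p + 1) q r s) =
      blockWord A B 0 0 E p (q + 1) r s := by
  have h1 : blockWord A B 0 0 E (p + 1) q r s =
      (rep s [3] ++ (rep r [2] ++ (rep q [1]))) ++ ([0] ++ (rep p [0] ++ (rep E [2, 3] ++
        (rep B [0, 2] ++ (rep A [0, 1]))))) := by
    simp [blockWord, rep_zero, rep_succ]
  have h2 : blockWord A B 0 0 E p (q + 1) r s =
      (rep s [3] ++ (rep r [2] ++ (rep q [1]))) ++ ([1] ++ (rep p [0] ++ (rep E [2, 3] ++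
        (rep B [0, 2] ++ (rep A [0, 1]))))) := by
    simp [blockWord, rep_zero, rep_succ']
  have h3 : lower .n1 [0] = [1] := by decide
  have h4 : eps .n1 [0] = 0 := by decide
  have h5 : phi .n1 [0] = 1 := by decide
  rw [h1, h2, lower_append_append, h3]
  all_goals
    simp only [h4, h5, eps_append, phi_append, sig1_0, sig1_1, sig1_2, sig1_3, sig1_01, sig1_02, sig1_13,
      sig1_23]
    omega

theorem lower1_blockWord_B (A B D E q r s : ℕ) (h : r ≤ q + 2 * D) :
    lower .n1 (blockWord A (B + 1) 0 D E 0 q r s) =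
      blockWord A B 1 D E 0 q r s := by
  have h1 : blockWord A (B + 1) 0 D E 0 q r s =
      (rep s [3] ++ (rep r [2] ++ (rep q [1] ++ (rep E [2, 3] ++ (rep D [1, 3]))))) ++
        ([0, 2] ++ (rep B [0, 2] ++ (rep A [0, 1]))) := by
    simp [blockWord, rep_zero, rep_succ]
  have h2 : blockWord A B 1 D E 0 q r s =
      (rep s [3] ++ (rep r [2] ++ (rep q [1] ++ (rep E [2, 3] ++ (rep D [1, 3]))))) ++
        ([1, 2] ++ (rep B [0, 2] ++ (rep A [0, 1]))) := by
    simp [blockWord, rep_zero, rep_succ']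
  have h3 : lower .n1 [0, 2] = [1, 2] := by decide
  have h4 : eps .n1 [0, 2] = 0 := by decide
  have h5 : phi .n1 [0, 2] = 2 := by decide
  rw [h1, h2, lower_append_append, h3]
  all_goals
    simp only [h4, h5, eps_append, phi_append, sig1_0, sig1_1, sig1_2, sig1_3, sig1_01, sig1_02, sig1_13,
      sig1_23]
    omega

theorem lower1_blockWord_C (A B D E q r s : ℕ) (h : r ≤ q + 2 * D + 1) :
    lower .n1 (blockWord A B 1 D E 0 q r s) =
      blockWord A B 0 (D + 1) E 0 q r s := by
  have h1 : blockWord A B 1 D E 0 q r s =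
      (rep s [3] ++ (rep r [2] ++ (rep q [1] ++ (rep E [2, 3] ++ (rep D [1, 3]))))) ++
        ([1, 2] ++ (rep B [0, 2] ++ (rep A [0, 1]))) := by
    simp [blockWord, rep_zero, rep_succ]
  have h2 : blockWord A B 0 (D + 1) E 0 q r s =
      (rep s [3] ++ (rep r [2] ++ (rep q [1] ++ (rep E [2, 3] ++ (rep D [1, 3]))))) ++
        ([1, 3] ++ (rep B [0, 2] ++ (rep A [0, 1]))) := by
    simp [blockWord, rep_zero, rep_succ']
  have h3 : lower .n1 [1, 2] = [1, 3] := by decide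
  have h4 : eps .n1 [1, 2] = 1 := by decide
  have h5 : phi .n1 [1, 2] = 1 := by decide
  rw [h1, h2, lower_append_append, h3]
  all_goals
    simp only [h4, h5, eps_append, phi_append, sig1_0, sig1_1, sig1_2, sig1_3, sig1_01, sig1_02, sig1_13,
      sig1_23]
    omega


theorem blockWord_congr {A B C D E p q r s A' B' C' D' E' p' q' r' s' : ℕ} (hA : A = A')
    (hB : B = B') (hC : C = C') (hD : D = D') (hE : E = E') (hp : p = p') (hq : q = q')
    (hr : r = r') (hs : s = s') :
    blockWord A B C D E p q r s = blockWord A' B' C' D' E' p' q' r' s' := by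
  subst hA hB hC hD hE hp hq hr hs; rfl

/-! ### Adapted strings of block words -/

theorem iterate_raise2_B (A B C D E p q r s k : ℕ) (h : D + (q - E) ≤ B) :
    (raise .n2)^[k] (blockWord A (B + k) C D E p q r s) = blockWord (A + k) B C D E p q r s := by
  induction k generalizing A with
  | zero => rfl
  | succ k ih =>
    rw [Function.iterate_succ_apply, ← add_assoc, raise2_blockWord_B _ _ _ _ _ _ _ _ _ (by omega),
      ih, add_right_comm A 1 k, add_assoc A k 1]

theorem iterate_raise2_E (A B C D E p q r s k : ℕ) (h : q ≤ E) (h' : B ≤ D) :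
    (raise .n2)^[k] (blockWord A B C D (E + k) p q r s) = blockWord A B C (D + k) E p q r s := by
  induction k generalizing D with
  | zero => rfl
  | succ k ih =>
    rw [Function.iterate_succ_apply, ← add_assoc,
      raise2_blockWord_E _ _ _ _ _ _ _ _ _ (by omega) h', ih _ (by omega),
      add_right_comm D 1 k, add_assoc D k 1]

theorem iterate_raise2_r (A B C D E p q r s k : ℕ) (h : E + (B - D) ≤ q) :
    (raise .n2)^[k] (blockWord A B C D E p q (r + k) s) = blockWord A B C D E p (q + k) r s := by
  induction k generalizing q with
  | zero => rfl
  | succ k ih =>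
    rw [Function.iterate_succ_apply, ← add_assoc,
      raise2_blockWord_r _ _ _ _ _ _ _ _ _ h, ih _ (by omega),
      add_right_comm q 1 k, add_assoc q k 1]

/-- The surviving `-` come, from left to right, from the letters `2̄`, the columns `2̄ 1̄` and the
`B - D - q` uncancelled columns `1 2̄`. The operator uses them from right to left, so the three
kinds are raised in the opposite order. -/
theorem raiseMax2_blockWord (A B C D E p q r s : ℕ) (h : E = 0 ∨ q = 0) :
    raiseMax .n2 (blockWord A B C D E p q r s) =
      blockWord (A + (B - D - q)) (B - (B - D - q)) C (D + E) 0 p (q + r) 0 s := by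
  obtain ⟨u, hu⟩ : ∃ u, u = B - D - q := ⟨_, rfl⟩
  obtain ⟨B', hB'⟩ : ∃ B', B' = B - u := ⟨_, rfl⟩
  have hB : B = B' + u := by omega
  have he : eps .n2 (blockWord A B C D E p q r s) = r + (E + u) := by
    rw [eps2_blockWord]; omega
  rw [raiseMax, he, Function.iterate_add_apply, Function.iterate_add_apply, ← hu, ← hB', hB]
  rcases Nat.eq_zero_or_pos u with h0 | h0
  · subst h0
    simp only [Function.iterate_zero, id, add_zero]
    rcases Nat.eq_zero_or_pos E with h1 | h1
    · subst h1
      simp only [Function.iterate_zero, id, add_zero]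
      simpa using iterate_raise2_r A B' C D 0 p q 0 s r (by omega)
    · have := iterate_raise2_E A B' C D 0 p q r s E (by omega) (by omega)
      rw [zero_add] at this
      rw [this]
      simpa using iterate_raise2_r A B' C (D + E) 0 p q 0 s r (by omega)
  · rw [iterate_raise2_B _ _ _ _ _ _ _ _ _ _ (by omega)]
    rcases Nat.eq_zero_or_pos E with h1 | h1
    · subst h1
      simp only [Function.iterate_zero, id, add_zero]
      simpa using iterate_raise2_r (A + u) B' C D 0 p q 0 s r (by omega)
    · have := iterate_raise2_E (A + u) B' C D 0 p q r s E (by omega) (by omega)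
      rw [zero_add] at this
      rw [this]
      simpa using iterate_raise2_r (A + u) B' C (D + E) 0 p q 0 s r (by omega)

/-! ### Points: coordinates on Kashiwara–Nakashima tableaux adapted to node 1 -/

/-- Coordinates of a Kashiwara–Nakashima tableau. As a crystal for node 1, `B(l ϖ₁ + m ϖ₂)` is the
disjoint union, over the values of `R`, `Q`, `A`, `K`, `E`, of tensor products of a string of
length `R` and a string of length `Q + 2 K`; the positions in these strings are `r` and `x`. -/
@[ext]
structure Point where
  R : ℕ
  Q : ℕ
  A : ℕ
  K : ℕ
  E : ℕ
  r : ℕ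
  x : ℕ

namespace Point

structure Valid (l m : ℕ) (P : Point) : Prop where
  hl : P.R + P.Q = l
  hm : P.A + P.K + P.E = m
  hE : P.E = 0 ∨ P.Q = 0
  hr : P.r ≤ P.R
  hx : P.x ≤ P.Q + 2 * P.K

/-- The position `x` first turns the `Q` letters `1` into `2`; after that every two steps take one
of the `K` columns through `1 2̄`, `2 2̄`, `2 1̄`. The truncated difference `x - Q` counts the steps
of the second phase. -/
def word (P : Point) : Word :=
  blockWord P.A (P.K - (P.x - P.Q) % 2 - (P.x - P.Q) / 2) ((P.x - P.Q) % 2) ((P.x - P.Q) / 2) P.E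
    (P.Q - P.x) (min P.x P.Q) P.r (P.R - P.r)

end Point

theorem blockWord_eq_word (A B C D E p q r s : ℕ) (hC : C ≤ 1) (h : p = 0 ∨ C = 0 ∧ D = 0) :
    blockWord A B C D E p q r s =
      Point.word ⟨r + s, p + q, A, B + C + D, E, r, q + 2 * D + C⟩ := by
  simp only [Point.word]
  congr 1 <;> omega

/-! ### Operators for node 1, adapted strings and the action of `s₁` in coordinates. -/

namespace Point

/-- Tensor product rule: the 1-signature reduces to `(-)^(R-r) (+)^r (-)^x (+)^(Q+2K-x)`, and the
only remaining cancellation is between `(+)^r` and `(-)^x`. -/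
theorem eps1_word {l m : ℕ} {P : Point} (h : P.Valid l m) :
    eps .n1 P.word = (P.R - P.r) + (P.x - P.r) := by
  obtain ⟨h1, h2, h3, h4, h5⟩ := h
  rw [word, eps1_blockWord _ _ _ _ _ _ _ _ _ (by omega)]
  omega

theorem phi1_word {l m : ℕ} {P : Point} (h : P.Valid l m) :
    phi .n1 P.word = (P.Q + 2 * P.K - P.x) + (P.r - P.x) := by
  have h6 := eps1_word h
  obtain ⟨h1, h2, h3, h4, h5⟩ := h
  have := phi1_blockWord P.A (P.K - (P.x - P.Q) % 2 - (P.x - P.Q) / 2) ((P.x - P.Q) % 2)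
    ((P.x - P.Q) / 2) P.E (P.Q - P.x) (min P.x P.Q) P.r (P.R - P.r) (by omega)
  rw [← word, h6] at this
  omega

theorem raise1_word_x (R Q A K E r x : ℕ) (h : r ≤ x) (hx : x + 1 ≤ Q + 2 * K) :
    raise .n1 (word ⟨R, Q, A, K, E, r, x + 1⟩) = word ⟨R, Q, A, K, E, r, x⟩ := by
  rcases Nat.lt_or_ge x Q with h1 | h1
  · have := raise1_blockWord_q A K 0 0 E (Q - (x + 1)) x r (R - r) (by omega) (by omega) (by omega)
    simp only [word]
    refine (congrArg (raise .n1) ?_).trans (this.trans ?_) <;> apply blockWord_congr <;> omega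
  · obtain ⟨D, hD⟩ := Nat.even_or_odd' (x - Q)
    rcases hD with hD | hD
    · have := raise1_blockWord_C A (K - D - 1) D E Q r (R - r) (by omega)
      simp only [word]
      refine (congrArg (raise .n1) ?_).trans (this.trans ?_) <;> apply blockWord_congr <;> omega
    · have := raise1_blockWord_D A (K - D - 1) D E Q r (R - r) (by omega)
      simp only [word]
      refine (congrArg (raise .n1) ?_).trans (this.trans ?_) <;> apply blockWord_congr <;> omega

theorem raise1_word_r (R Q A K E r x : ℕ) (h : x ≤ r) (hr : r + 1 ≤ R) :
    raise .n1 (word ⟨R, Q, A, K, E, r, x⟩) = word ⟨R, Q, A, K, E, r + 1, x⟩ := by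
  have := raise1_blockWord_s A (K - (x - Q) % 2 - (x - Q) / 2) ((x - Q) % 2) ((x - Q) / 2) E
    (Q - x) (min x Q) r (R - r - 1) (by omega) (by omega)
  simp only [word]
  refine (congrArg (raise .n1) ?_).trans (this.trans ?_) <;> apply blockWord_congr <;> omega

theorem lower1_word_x (R Q A K E r x : ℕ) (h : r ≤ x) (hx : x + 1 ≤ Q + 2 * K) :
    lower .n1 (word ⟨R, Q, A, K, E, r, x⟩) = word ⟨R, Q, A, K, E, r, x + 1⟩ := by
  rcases Nat.lt_or_ge x Q with h1 | h1
  · have := lower1_blockWord_p A K E (Q - (x + 1)) x r (R - r) (by omega)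
    simp only [word]
    refine (congrArg (lower .n1) ?_).trans (this.trans ?_) <;> apply blockWord_congr <;> omega
  · obtain ⟨D, hD⟩ := Nat.even_or_odd' (x - Q)
    rcases hD with hD | hD
    · have := lower1_blockWord_B A (K - D - 1) D E Q r (R - r) (by omega)
      simp only [word]
      refine (congrArg (lower .n1) ?_).trans (this.trans ?_) <;> apply blockWord_congr <;> omega
    · have := lower1_blockWord_C A (K - D - 1) D E Q r (R - r) (by omega)
      simp only [word]
      refine (congrArg (lower .n1) ?_).trans (this.trans ?_) <;> apply blockWord_congr <;> omega

theorem lower1_word_r (R Q A K E r x : ℕ) (h : x ≤ r) (hr : r + 1 ≤ R) :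
    lower .n1 (word ⟨R, Q, A, K, E, r + 1, x⟩) = word ⟨R, Q, A, K, E, r, x⟩ := by
  have := lower1_blockWord_r A (K - (x - Q) % 2 - (x - Q) / 2) ((x - Q) % 2) ((x - Q) / 2) E
    (Q - x) (min x Q) r (R - r - 1) (by omega) (by omega)
  simp only [word]
  refine (congrArg (lower .n1) ?_).trans (this.trans ?_) <;> apply blockWord_congr <;> omega

theorem iterate_raise1_word_x (R Q A K E r x k : ℕ) (h : r ≤ x) (hx : x + k ≤ Q + 2 * K) :
    (raise .n1)^[k] (word ⟨R, Q, A, K, E, r, x + k⟩) = word ⟨R, Q, A, K, E, r, x⟩ := by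
  induction k with
  | zero => rfl
  | succ k ih =>
    rw [Function.iterate_succ_apply, ← add_assoc, raise1_word_x _ _ _ _ _ _ _ (by omega) (by omega),
      ih (by omega)]

theorem iterate_raise1_word_r (R Q A K E r x k : ℕ) (h : x ≤ r) (hr : r + k ≤ R) :
    (raise .n1)^[k] (word ⟨R, Q, A, K, E, r, x⟩) = word ⟨R, Q, A, K, E, r + k, x⟩ := by
  induction k with
  | zero => rfl
  | succ k ih =>
    rw [Function.iterate_succ_apply', ih (by omega), raise1_word_r _ _ _ _ _ _ _ (by omega)
      (by omega), add_assoc]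

theorem iterate_lower1_word_x (R Q A K E r x k : ℕ) (h : r ≤ x) (hx : x + k ≤ Q + 2 * K) :
    (lower .n1)^[k] (word ⟨R, Q, A, K, E, r, x⟩) = word ⟨R, Q, A, K, E, r, x + k⟩ := by
  induction k with
  | zero => rfl
  | succ k ih =>
    rw [Function.iterate_succ_apply', ih (by omega), lower1_word_x _ _ _ _ _ _ _ (by omega)
      (by omega), add_assoc]

theorem iterate_lower1_word_r (R Q A K E r x k : ℕ) (h : x ≤ r) (hr : r + k ≤ R) :
    (lower .n1)^[k] (word ⟨R, Q, A, K, E, r + k, x⟩) = word ⟨R, Q, A, K, E, r, x⟩ := by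
  induction k with
  | zero => rfl
  | succ k ih =>
    rw [Function.iterate_succ_apply, ← add_assoc, lower1_word_r _ _ _ _ _ _ _ (by omega) (by omega),
      ih (by omega)]

/-- Going up a 1-string, `x` decreases until it no longer exceeds `r`, and only then does `r`
increase; `hb` says that the second phase starts after the first is complete. -/
theorem iterate_raise1_word (R Q A K E r x a b : ℕ) (ha : a ≤ x - r) (hb : b = 0 ∨ a = x - r)
    (hr : r + b ≤ R) (hx : x ≤ Q + 2 * K) :
    (raise .n1)^[b + a] (word ⟨R, Q, A, K, E, r, x⟩) = word ⟨R, Q, A, K, E, r + b, x - a⟩ := by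
  obtain ⟨x', rfl⟩ : ∃ x', x = x' + a := ⟨x - a, by omega⟩
  rcases Nat.lt_or_ge x' r with h | h
  · obtain rfl : a = 0 := by omega
    simpa using iterate_raise1_word_r R Q A K E r x' b (by omega) hr
  · rw [Function.iterate_add_apply, iterate_raise1_word_x _ _ _ _ _ _ _ _ h hx]
    rcases hb with rfl | hb
    · simp
    · simpa using iterate_raise1_word_r R Q A K E r x' b (by omega) hr

theorem iterate_lower1_word (R Q A K E r x a b : ℕ) (ha : a ≤ r - x) (hb : b = 0 ∨ a = r - x)
    (hr : r ≤ R) (hx : x + b ≤ Q + 2 * K) :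
    (lower .n1)^[b + a] (word ⟨R, Q, A, K, E, r, x⟩) = word ⟨R, Q, A, K, E, r - a, x + b⟩ := by
  obtain ⟨r', rfl⟩ : ∃ r', r = r' + a := ⟨r - a, by omega⟩
  rcases Nat.lt_or_ge r' x with h | h
  · obtain rfl : a = 0 := by omega
    simpa using iterate_lower1_word_x R Q A K E r' x b (by omega) hx
  · rw [Function.iterate_add_apply, iterate_lower1_word_r _ _ _ _ _ _ _ _ h hr]
    rcases hb with rfl | hb
    · simp
    · simpa using iterate_lower1_word_x R Q A K E r' x b (by omega) hx

theorem raiseMax1_word (R Q A K E x : ℕ) (hx : x ≤ Q + 2 * K) :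
    raiseMax .n1 (word ⟨R, Q, A, K, E, 0, x⟩) = blockWord A K 0 0 E Q 0 R 0 := by
  have he : eps .n1 (word ⟨R, Q, A, K, E, 0, x⟩) = R + x := by
    rw [word, eps1_blockWord _ _ _ _ _ _ _ _ _ (by omega)]
    dsimp only
    omega
  rw [raiseMax, he, iterate_raise1_word _ _ _ _ _ _ _ _ _ (by omega) (by omega) (by omega) hx]
  simp [word]

/-- The first maximal raising leads to a point with `r = 0`, `E = 0`, first string of length `R - r`
and `min K x + E` columns in the second. The next one takes both strings to their top. The third
entry then counts these columns together with the `R - r` letters `2̄`, and the last entry counts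
the same letters after they became `2`. -/
theorem str2Word_word {l m : ℕ} {P : Point} (h : P.Valid l m) :
    str2Word P.word = (P.r + P.E + (P.K - P.x), P.R + P.x + 2 * P.E,
      (P.R - P.r) + P.E + min P.K P.x, P.R - P.r) := by
  obtain ⟨h1, h2, h3, h4, h5⟩ := h
  have e1 := raiseMax2_blockWord P.A (P.K - (P.x - P.Q) % 2 - (P.x - P.Q) / 2) ((P.x - P.Q) % 2)
    ((P.x - P.Q) / 2) P.E (P.Q - P.x) (min P.x P.Q) P.r (P.R - P.r) (by omega)
  simp only [str2Word]
  rw [← word] at e1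
  have e0 : eps .n2 P.word = P.r + P.E + (P.K - P.x) := by
    rw [word, eps2_blockWord]; omega
  rw [blockWord_eq_word _ _ _ _ _ _ _ _ _ (by omega) (by omega)] at e1
  rw [e0, e1, raiseMax1_word _ _ _ _ _ _ (by omega), raiseMax2_blockWord _ _ _ _ _ _ _ _ _ (by omega),
    ← blockWord_eq_word _ _ _ _ _ _ _ _ _ (by omega) (by omega),
    eps1_blockWord _ _ _ _ _ _ _ _ _ (by omega), eps1_blockWord _ _ _ _ _ _ _ _ _ (by omega),
    eps2_blockWord]
  simp only [Prod.mk.injEq]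
  refine ⟨trivial, ?_, ?_, ?_⟩ <;> omega

/-- `P'` is the image of `P` under `s₁`. -/
structure IsRefl (P P' : Point) : Prop where
  R : P'.R = P.R
  Q : P'.Q = P.Q
  A : P'.A = P.A
  K : P'.K = P.K
  E : P'.E = P.E
  hmin : min P'.r P'.x = min P.r P.x
  hsum : P.r + P'.r + (P.Q + 2 * P.K) = P.x + P'.x + P.R

/-- The number `min r x` of cancelled pairs is constant along a 1-string, so together with the sign
change of the first weight coordinate it determines the mirror image. -/
theorem reflectWord_word {l m : ℕ} {P P' : Point} (h : P.Valid l m) (h' : P'.Valid l m)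
    (hP : P.IsRefl P') : reflectWord .n1 P.word = P'.word := by
  have h1 := eps1_word h
  have h2 := phi1_word h
  obtain ⟨-, -, -, h6, h7⟩ := h
  obtain ⟨-, -, -, k6, k7⟩ := h'
  obtain ⟨R, Q, A, K, E, r, x⟩ := P
  obtain ⟨R', Q', A', K', E', r', x'⟩ := P'
  obtain ⟨rfl, rfl, rfl, rfl, rfl, g1, g2⟩ := hP
  dsimp only at *
  rw [reflectWord, h1, h2]
  split_ifs with h3
  · have := iterate_raise1_word R' Q' A' K' E' r x (x - x') (r' - r) (by omega) (by omega)
      (by omega) (by omega)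
    rw [show R' - r + (x - r) - (Q' + 2 * K' - x + (r - x)) = r' - r + (x - x') by omega, this,
      show r + (r' - r) = r' by omega, show x - (x - x') = x' by omega]
  · have := iterate_lower1_word R' Q' A' K' E' r x (r - r') (x' - x) (by omega) (by omega)
      (by omega) (by omega)
    rw [show Q' + 2 * K' - x + (r - x) - (R' - r + (x - r)) = x' - x + (r - r') by omega, this,
      show r - (r - r') = r' by omega, show x + (x' - x) = x' by omega]

end Point

/-! ### Kashiwara–Nakashima tableaux made of blocks of equal columns -/

namespace Tableau

/-- The tableau with columns `cs` of height two followed by columns `ss` of height one. -/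
def ofColumns (cs : List (Letter × Letter)) (ss : List Letter) : Tableau where
  row1 := cs.map Prod.fst ++ ss
  row2 := cs.map Prod.snd

theorem _root_.List.map_fst_zip_eq_take {α β : Type*} {a : List α} {b : List β}
    (h : b.length ≤ a.length) : (a.zip b).map Prod.fst = a.take b.length := by
  induction a generalizing b with
  | nil => simp
  | cons x a ih =>
    cases b with
    | nil => simp
    | cons y b => simp [ih (by simpa using h)]

theorem split_eq_ofColumns (T : Tableau) :
    T.split = ofColumns (T.columns.flatMap fun c => [leftSplit c, rightSplit c])
      (T.singles.flatMap fun x => [x, x]) := by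
  simp [split, ofColumns, List.map_flatMap]

theorem columns_ofColumns (cs : List (Letter × Letter)) (ss : List Letter) :
    (ofColumns cs ss).columns = cs := by
  induction cs with
  | nil => simp [ofColumns, columns]
  | cons c cs ih =>
    simp only [ofColumns, columns] at ih
    simp [ofColumns, columns, ih]

theorem singles_ofColumns (cs : List (Letter × Letter)) (ss : List Letter) :
    (ofColumns cs ss).singles = ss := by
  simp [ofColumns, singles]

theorem ofColumns_columns_singles (T : Tableau) (h : T.row2.length ≤ T.row1.length) :
    ofColumns T.columns T.singles = T := by
  obtain ⟨a, b⟩ := T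
  simp only [ofColumns, columns, singles] at *
  rw [List.map_snd_zip h, List.map_fst_zip_eq_take h, List.take_append_drop]

end Tableau

open Tableau

def blockColumns (A B C D E : ℕ) : List (Letter × Letter) :=
  List.replicate A (0, 1) ++ (List.replicate B (0, 2) ++ (List.replicate C (1, 2) ++
    (List.replicate D (1, 3) ++ List.replicate E (2, 3))))

def blockSingles (p q r s : ℕ) : List Letter :=
  List.replicate p 0 ++ (List.replicate q 1 ++ (List.replicate r 2 ++ List.replicate s 3))

def blockTableau (A B C D E p q r s : ℕ) : Tableau :=
  ofColumns (blockColumns A B C D E) (blockSingles p q r s)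

theorem word_blockTableau (A B C D E p q r s : ℕ) :
    (blockTableau A B C D E p q r s).word = blockWord A B C D E p q r s := by
  have h (n : ℕ) (x : Letter) : rep n [x] = List.replicate n x := by
    induction n with
    | zero => rfl
    | succ n ih => simp [rep_succ, ih, List.replicate_succ]
  have h' (n : ℕ) (x y : Letter) :
      List.flatMap (fun c : Letter × Letter => [c.1, c.2]) (List.replicate n (x, y)) =
        rep n [x, y] := by
    induction n with
    | zero => rfl
    | succ n ih => simp [rep_succ, ih, List.replicate_succ]
  simp [blockTableau, Tableau.word, columns_ofColumns, singles_ofColumns, blockColumns,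
    blockSingles, blockWord, h, h', List.flatMap_append]

theorem exists_eq_blockSingles (L : List Letter) (h : L.Pairwise (· ≤ ·)) :
    ∃ p q r s, L = blockSingles p q r s := by
  induction L with
  | nil => exact ⟨0, 0, 0, 0, rfl⟩
  | cons c L ih =>
    rw [List.pairwise_cons] at h
    obtain ⟨p, q, r, s, rfl⟩ := ih h.2
    have h0 : p ≠ 0 → c ≤ 0 := fun hp => h.1 0 (by simp [blockSingles, hp])
    have h1 : q ≠ 0 → c ≤ 1 := fun hp => h.1 1 (by simp [blockSingles, hp])
    have h2 : r ≠ 0 → c ≤ 2 := fun hp => h.1 2 (by simp [blockSingles, hp])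
    fin_cases c
    · exact ⟨p + 1, q, r, s, rfl⟩
    · obtain rfl : p = 0 := by_contra fun hp => absurd (h0 hp) (by decide)
      exact ⟨0, q + 1, r, s, rfl⟩
    · obtain rfl : p = 0 := by_contra fun hp => absurd (h0 hp) (by decide)
      obtain rfl : q = 0 := by_contra fun hp => absurd (h1 hp) (by decide)
      exact ⟨0, 0, r + 1, s, rfl⟩
    · obtain rfl : p = 0 := by_contra fun hp => absurd (h0 hp) (by decide)
      obtain rfl : q = 0 := by_contra fun hp => absurd (h1 hp) (by decide)
      obtain rfl : r = 0 := by_contra fun hp => absurd (h2 hp) (by decide)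
      exact ⟨0, 0, 0, s + 1, rfl⟩

theorem column_cases (c : Letter × Letter) (h : c.1 < c.2) (h' : Admissible c) :
    c = (0, 1) ∨ c = (0, 2) ∨ c = (1, 2) ∨ c = (1, 3) ∨ c = (2, 3) := by
  unfold Admissible at h'
  revert c
  decide

/-- The five admissible columns form a chain for the componentwise order, so a weakly increasing
list of them is a concatenation of constant blocks. -/
theorem exists_eq_blockColumns (L : List (Letter × Letter))
    (h : L.Pairwise fun c d => c.1 ≤ d.1 ∧ c.2 ≤ d.2)
    (h' : ∀ c ∈ L, c.1 < c.2 ∧ Admissible c) : ∃ A B C D E, L = blockColumns A B C D E := by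
  induction L with
  | nil => exact ⟨0, 0, 0, 0, 0, rfl⟩
  | cons c L ih =>
    rw [List.pairwise_cons] at h
    obtain ⟨A, B, C, D, E, rfl⟩ := ih h.2 fun c hc => h' c (by simp [hc])
    have hc := h' c (by simp)
    have h0 : A ≠ 0 → _ := fun hp => h.1 (0, 1) (by simp [blockColumns, hp])
    have h1 : B ≠ 0 → _ := fun hp => h.1 (0, 2) (by simp [blockColumns, hp])
    have h2 : C ≠ 0 → _ := fun hp => h.1 (1, 2) (by simp [blockColumns, hp])
    have h3 : D ≠ 0 → _ := fun hp => h.1 (1, 3) (by simp [blockColumns, hp])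
    rcases column_cases c hc.1 hc.2 with rfl | rfl | rfl | rfl | rfl
    · exact ⟨A + 1, B, C, D, E, rfl⟩
    · obtain rfl : A = 0 := by_contra fun hp => absurd (h0 hp) (by decide)
      exact ⟨0, B + 1, C, D, E, rfl⟩
    · obtain rfl : A = 0 := by_contra fun hp => absurd (h0 hp) (by decide)
      obtain rfl : B = 0 := by_contra fun hp => absurd (h1 hp) (by decide)
      exact ⟨0, 0, C + 1, D, E, rfl⟩
    · obtain rfl : A = 0 := by_contra fun hp => absurd (h0 hp) (by decide)
      obtain rfl : B = 0 := by_contra fun hp => absurd (h1 hp) (by decide)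
      obtain rfl : C = 0 := by_contra fun hp => absurd (h2 hp) (by decide)
      exact ⟨0, 0, 0, D + 1, E, rfl⟩
    · obtain rfl : A = 0 := by_contra fun hp => absurd (h0 hp) (by decide)
      obtain rfl : B = 0 := by_contra fun hp => absurd (h1 hp) (by decide)
      obtain rfl : C = 0 := by_contra fun hp => absurd (h2 hp) (by decide)
      obtain rfl : D = 0 := by_contra fun hp => absurd (h3 hp) (by decide)
      exact ⟨0, 0, 0, 0, E + 1, rfl⟩

theorem pairwise_of_rows (cs : List (Letter × Letter)) (h1 : (cs.map Prod.fst).Pairwise (· ≤ ·))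
    (h2 : (cs.map Prod.snd).Pairwise (· ≤ ·)) :
    cs.Pairwise fun c d => c.1 ≤ d.1 ∧ c.2 ≤ d.2 :=
  (List.pairwise_map.1 h1).and (List.pairwise_map.1 h2)

theorem exists_eq_blockTableau {l m : ℕ} {T : Tableau} (h : T.IsKN l m) :
    ∃ A B C D E p q r s, T = blockTableau A B C D E p q r s ∧ C ≤ 1 ∧
      (p = 0 ∨ C = 0 ∧ D = 0 ∧ E = 0) ∧ (q = 0 ∨ E = 0) ∧
      p + q + r + s = l ∧ A + B + C + D + E = m := by
  obtain ⟨h1, h2, ⟨h3, h4, h5⟩, h6, h7⟩ := h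
  have hT := ofColumns_columns_singles T (by omega)
  generalize T.columns = cs at *
  generalize T.singles = ss at *
  subst hT
  simp only [ofColumns] at h1 h2 h3 h4
  rw [List.pairwise_append] at h3
  obtain ⟨A, B, C, D, E, rfl⟩ := exists_eq_blockColumns cs (pairwise_of_rows cs h3.1 h4)
    fun c hc => ⟨h5 c hc, h6 c hc⟩
  obtain ⟨p, q, r, s, rfl⟩ := exists_eq_blockSingles ss h3.2.1
  have hl : p + q + r + s = l := by
    simp [blockColumns, blockSingles] at h1 h2; omega
  have hm : A + B + C + D + E = m := by
    simp [blockColumns] at h2; omega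
  refine ⟨A, B, C, D, E, p, q, r, s, rfl, ?_, ?_, ?_, hl, hm⟩
  · by_contra hC
    -- Two columns `2 2̄` would split into the top row `1 2 1 2`, which is not weakly increasing.
    have hs : List.Sublist [((1, 2) : Letter × Letter), (1, 2)] (blockColumns A B C D E) := by
      refine List.Sublist.trans ?_ (List.sublist_append_right _ _)
      refine List.Sublist.trans ?_ (List.sublist_append_right _ _)
      refine List.Sublist.trans ?_ (List.sublist_append_left _ _)
      exact List.replicate_sublist_replicate (1, 2) |>.2 (show 2 ≤ C by omega)
    have h8 := h7.1
    simp only [Tableau.split, columns_ofColumns] at h8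
    have h9 := h8.sublist ((hs.flatMap _).trans (List.sublist_append_left _ _))
    revert h9
    decide
  · by_contra! hp
    have h0 : (0 : Letter) ∈ blockSingles p q r s := by simp [blockSingles, hp.1]
    have hC : C = 0 := by
      by_contra hC
      exact absurd (h3.2.2 1 (by simp [blockColumns, hC]) 0 h0) (by decide)
    have hD : D = 0 := by
      by_contra hC
      exact absurd (h3.2.2 1 (by simp [blockColumns, hC]) 0 h0) (by decide)
    have hE : E = 0 := by
      by_contra hC
      exact absurd (h3.2.2 2 (by simp [blockColumns, hC]) 0 h0) (by decide)
    exact hp.2 hC hD hE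
  · by_contra! hq
    exact absurd (h3.2.2 2 (by simp [blockColumns, hq.2]) 1 (by simp [blockSingles, hq.1]))
      (by decide)

theorem isKN_blockTableau {A B C D E p q r s : ℕ} (hC : C ≤ 1)
    (hp : p = 0 ∨ C = 0 ∧ D = 0 ∧ E = 0) (hq : q = 0 ∨ E = 0) :
    (blockTableau A B C D E p q r s).IsKN (p + q + r + s) (A + B + C + D + E) := by
  refine ⟨?_, ?_, ⟨?_, ?_, ?_⟩, ?_, ⟨?_, ?_, ?_⟩⟩
  · simp [blockTableau, ofColumns, blockColumns, blockSingles]; omega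
  · simp [blockTableau, ofColumns, blockColumns]; omega
  · simp +contextual only [blockTableau, ofColumns, blockColumns, blockSingles,
      List.pairwise_append, List.pairwise_replicate, List.map_append, List.map_replicate,
      List.mem_append, List.mem_replicate, or_imp, forall_and, and_imp]
    simp
    omega
  · simp +contextual [blockTableau, ofColumns, blockColumns, List.pairwise_append,
      List.pairwise_replicate, or_imp]
  · simp only [blockTableau, columns_ofColumns]
    simp [blockColumns, or_imp, forall_and]
  · simp only [blockTableau, columns_ofColumns, Admissible]
    simp [blockColumns, or_imp, forall_and]
  · simp only [blockTableau, Tableau.split, columns_ofColumns, singles_ofColumns]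
    simp only [List.pairwise_append, List.pairwise_flatMap, blockColumns, blockSingles]
    simp [List.pairwise_replicate, or_imp, forall_and, leftSplit, rightSplit]
    omega
  · simp only [blockTableau, Tableau.split, columns_ofColumns]
    simp only [List.pairwise_append, List.pairwise_flatMap, blockColumns]
    simp [List.pairwise_replicate, or_imp, forall_and, leftSplit, rightSplit]
    omega
  · simp only [split_eq_ofColumns, blockTableau, columns_ofColumns]
    simp [blockColumns, or_imp, forall_and, leftSplit, rightSplit]

theorem blockTableau_congr {A B C D E p q r s A' B' C' D' E' p' q' r' s' : ℕ} (hA : A = A')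
    (hB : B = B') (hC : C = C') (hD : D = D') (hE : E = E') (hp : p = p') (hq : q = q')
    (hr : r = r') (hs : s = s') :
    blockTableau A B C D E p q r s = blockTableau A' B' C' D' E' p' q' r' s' := by
  subst hA hB hC hD hE hp hq hr hs; rfl

/-! ### The embedding `Φ` on blocks -/

/-- Here `cs` lists the columns before the replacement, so the inadmissible column `1 1̄` may occur
in it. -/
theorem Phi_eq_ofColumns {T : Tableau} {cs : List (Letter × Letter)} {ss : List Letter}
    (h1 : 0 :: (T.row1 ++ [3]) = cs.map Prod.fst ++ ss) (h2 : T.row2 = cs.map Prod.snd) :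
    T.Phi = ofColumns (cs.map fun c => if c = (0, 3) then (1, 2) else c) ss := by
  have h : T.Phi' = ofColumns cs ss := by
    simp only [Phi', ofColumns, h1, h2]
  simp only [Phi, h, columns_ofColumns, singles_ofColumns]
  rfl

theorem cons_replicate_append {α : Type*} (n : ℕ) (a : α) (L : List α) :
    a :: (List.replicate n a ++ L) = List.replicate n a ++ a :: L := by
  rw [← List.cons_append, ← List.replicate_succ, List.replicate_succ', List.append_assoc]
  rfl

theorem replicate_append_singleton {α : Type*} (n : ℕ) (a : α) :
    List.replicate n a ++ [a] = a :: List.replicate n a := by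
  rw [← List.replicate_succ', List.replicate_succ]

/-- The new `1` shifts the top row by one place: only columns where the top letter jumps are
altered, and the last top entry is expelled into the columns of height one. The cases differ in
where these jumps occur and in whether a column `1 1̄` arises. -/
theorem Phi_blockTableau_p (A B p q r s : ℕ) :
    (blockTableau A B 0 0 0 p q r s).Phi = blockTableau A B 0 0 0 (p + 1) q r (s + 1) := by
  rw [Phi_eq_ofColumns (cs := blockColumns A B 0 0 0) (ss := blockSingles (p + 1) q r (s + 1))]
  · simp [blockTableau, blockColumns]
  · simp [blockTableau, ofColumns, blockColumns, blockSingles, replicate_append_singleton,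
      List.replicate_succ, cons_replicate_append]
  · simp [blockTableau, ofColumns, blockColumns]

theorem Phi_blockTableau_q (A B D q r s : ℕ) :
    (blockTableau A B 0 (D + 1) 0 0 q r s).Phi = blockTableau A B 1 D 0 0 (q + 1) r (s + 1) := by
  rw [Phi_eq_ofColumns (cs := List.replicate A (0, 1) ++ (List.replicate B (0, 2) ++
    ((0, 3) :: List.replicate D (1, 3)))) (ss := blockSingles 0 (q + 1) r (s + 1))]
  · simp [blockTableau, blockColumns]
  · simp [blockTableau, ofColumns, blockColumns, blockSingles, replicate_append_singleton,
      List.replicate_succ, cons_replicate_append]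
  · simp [blockTableau, ofColumns, blockColumns, List.replicate_succ]

theorem Phi_blockTableau_q' (A B D q r s : ℕ) :
    (blockTableau A B 1 D 0 0 q r s).Phi = blockTableau A (B + 1) 0 D 0 0 (q + 1) r (s + 1) := by
  rw [Phi_eq_ofColumns (cs := blockColumns A (B + 1) 0 D 0) (ss := blockSingles 0 (q + 1) r (s + 1))]
  · simp [blockTableau, blockColumns]
  · simp [blockTableau, ofColumns, blockColumns, blockSingles, replicate_append_singleton,
      List.replicate_succ, cons_replicate_append]
  · simp [blockTableau, ofColumns, blockColumns, List.replicate_succ, cons_replicate_append]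

theorem Phi_blockTableau_E (A B D E r s : ℕ) :
    (blockTableau A B 0 D (E + 1) 0 0 r s).Phi =
      blockTableau A B 1 D E 0 0 (r + 1) (s + 1) := by
  rw [Phi_eq_ofColumns (cs := List.replicate A (0, 1) ++ (List.replicate B (0, 2) ++
    ((0, 3) :: (List.replicate D (1, 3) ++ List.replicate E (2, 3)))))
    (ss := blockSingles 0 0 (r + 1) (s + 1))]
  · simp [blockTableau, blockColumns]
  · simp [blockTableau, ofColumns, blockColumns, blockSingles, replicate_append_singleton,
      List.replicate_succ, cons_replicate_append]
  · simp [blockTableau, ofColumns, blockColumns, List.replicate_succ, ← cons_replicate_append]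

theorem Phi_blockTableau_E' (A B D E r s : ℕ) :
    (blockTableau A B 1 D (E + 1) 0 0 r s).Phi =
      blockTableau A (B + 1) 0 (D + 1) E 0 0 (r + 1) (s + 1) := by
  rw [Phi_eq_ofColumns (cs := blockColumns A (B + 1) 0 (D + 1) E)
    (ss := blockSingles 0 0 (r + 1) (s + 1))]
  · simp [blockTableau, blockColumns]
  · simp [blockTableau, ofColumns, blockColumns, blockSingles, replicate_append_singleton,
      List.replicate_succ, cons_replicate_append]
  · simp [blockTableau, ofColumns, blockColumns, List.replicate_succ, cons_replicate_append]

/-! ### Points and tableaux -/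

namespace Point

def tableau (P : Point) : Tableau :=
  blockTableau P.A (P.K - (P.x - P.Q) % 2 - (P.x - P.Q) / 2) ((P.x - P.Q) % 2) ((P.x - P.Q) / 2)
    P.E (P.Q - P.x) (min P.x P.Q) P.r (P.R - P.r)

theorem word_tableau (P : Point) : P.tableau.word = P.word := word_blockTableau ..

theorem isKN_tableau {l m : ℕ} {P : Point} (h : P.Valid l m) : P.tableau.IsKN l m := by
  obtain ⟨h1, h2, h3, h4, h5⟩ := h
  have := isKN_blockTableau (A := P.A) (B := P.K - (P.x - P.Q) % 2 - (P.x - P.Q) / 2)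
    (C := (P.x - P.Q) % 2) (D := (P.x - P.Q) / 2) (E := P.E) (p := P.Q - P.x) (q := min P.x P.Q)
    (r := P.r) (s := P.R - P.r) (by omega) (by omega) (by omega)
  rw [tableau]
  convert this using 1 <;> omega

theorem exists_tableau_eq {l m : ℕ} {T : Tableau} (h : T.IsKN l m) :
    ∃ P : Point, P.Valid l m ∧ P.tableau = T := by
  obtain ⟨A, B, C, D, E, p, q, r, s, rfl, h1, h2, h3, h4, h5⟩ := exists_eq_blockTableau h
  refine ⟨⟨r + s, p + q, A, B + C + D, E, r, q + 2 * D + C⟩, ⟨?_, ?_, ?_, ?_, ?_⟩, ?_⟩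
  iterate 5 (dsimp only; omega)
  simp only [tableau]
  apply blockTableau_congr <;> omega

theorem crystal_eq (l m : ℕ) : crystal l m = tableau '' {P | P.Valid l m} := by
  ext T
  constructor
  · exact fun h => exists_tableau_eq h
  · rintro ⟨P, hP, rfl⟩
    exact isKN_tableau hP

theorem str2_tableau {l m : ℕ} {P : Point} (h : P.Valid l m) :
    P.tableau.str2 = (P.r + P.E + (P.K - P.x), P.R + P.x + 2 * P.E,
      (P.R - P.r) + P.E + min P.K P.x, P.R - P.r) := by
  rw [Tableau.str2, word_tableau, str2Word_word h]

/-- The combination `a + c - b` is `K - x`; then `a` and `d` give `r + E` and `R - r`, hence `R +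
E`. Since `E = 0` or `R = l`, this sum determines `R = min l (R + E)`, and everything else follows.
-/
theorem eq_of_str2_eq {l m : ℕ} {P P' : Point} (h : P.Valid l m) (h' : P'.Valid l m)
    (hs : P.tableau.str2 = P'.tableau.str2) : P = P' := by
  rw [str2_tableau h, str2_tableau h'] at hs
  simp only [Prod.mk.injEq] at hs
  obtain ⟨h1, h2, h3, h4, h5⟩ := h
  obtain ⟨k1, k2, k3, k4, k5⟩ := h'
  obtain ⟨s1, s2, s3, s4⟩ := hs
  have e1 : min P.K P.x + (P.K - P.x) = P.K := by omega
  have e2 : min P'.K P'.x + (P'.K - P'.x) = P'.K := by omega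
  have e3 : (P.K : ℤ) - P.x = P'.K - P'.x := by omega
  have e4 : P.K - P.x = P'.K - P'.x := by omega
  have e5 : P.R = P'.R := by
    generalize min P.K P.x = u at *
    generalize min P'.K P'.x = u' at *
    generalize P.K - P.x = v at *
    generalize P'.K - P'.x = v' at *
    rcases h3 with h3 | h3 <;> rcases k3 with k3 | k3 <;> omega
  have e6 : P.r = P'.r := by omega
  have e7 : P.E = P'.E := by omega
  ext <;> omega

theorem tableau_injOn (l m : ℕ) : Set.InjOn tableau {P | P.Valid l m} :=
  fun _ h _ h' e => eq_of_str2_eq h h' (by rw [e])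

theorem isReflection1_tableau {l m : ℕ} {P P' : Point} (h : P.Valid l m) (h' : P'.Valid l m)
    (hP : P.IsRefl P') : P.tableau.IsReflection1 P'.tableau := by
  have k := isKN_tableau h
  have k' := isKN_tableau h'
  refine ⟨k'.1.trans k.1.symm, k'.2.1.trans k.2.1.symm, ?_⟩
  rw [word_tableau, word_tableau, reflectWord_word h h' hP]

/-- The image of a point under `Φ`. -/
def phi (P : Point) : Point :=
  if P.E = 0 then { P with R := P.R + 1, Q := P.Q + 1 }
  else ⟨P.R + 2, P.Q, P.A, P.K + 1, P.E - 1, P.r + 1, P.x + 1⟩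

theorem Phi_tableau {l m : ℕ} {P : Point} (h : P.Valid l m) :
    P.tableau.Phi = P.phi.tableau := by
  obtain ⟨h1, h2, h3, h4, h5⟩ := h
  obtain ⟨R, Q, A, K, E, r, x⟩ := P
  dsimp only at *
  rcases Nat.eq_zero_or_pos E with rfl | hE
  · rcases Nat.lt_or_ge Q x with hx | hx
    · rcases Nat.even_or_odd' (x - Q) with ⟨D, hD | hD⟩
      · refine Eq.trans ?_ ((Phi_blockTableau_q A (K - D) (D - 1) Q r (R - r)).trans ?_)
        · congr 1; simp only [tableau]; apply blockTableau_congr <;> omega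
        · simp only [tableau, phi, if_true]; apply blockTableau_congr <;> omega
      · refine Eq.trans ?_ ((Phi_blockTableau_q' A (K - 1 - D) D Q r (R - r)).trans ?_)
        · congr 1; simp only [tableau]; apply blockTableau_congr <;> omega
        · simp only [tableau, phi, if_true]; apply blockTableau_congr <;> omega
    · refine Eq.trans ?_ ((Phi_blockTableau_p A K (Q - x) x r (R - r)).trans ?_)
      · congr 1; simp only [tableau]; apply blockTableau_congr <;> omega
      · simp only [tableau, phi, if_true]; apply blockTableau_congr <;> omega
  · rcases Nat.even_or_odd' (x - Q) with ⟨D, hD | hD⟩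
    · refine Eq.trans ?_ ((Phi_blockTableau_E A (K - D) D (E - 1) r (R - r)).trans ?_)
      · congr 1; simp only [tableau]; apply blockTableau_congr <;> omega
      · simp only [tableau, phi, if_neg hE.ne']; apply blockTableau_congr <;> omega
    · refine Eq.trans ?_ ((Phi_blockTableau_E' A (K - 1 - D) D (E - 1) r (R - r)).trans ?_)
      · congr 1; simp only [tableau]; apply blockTableau_congr <;> omega
      · simp only [tableau, phi, if_neg hE.ne']; apply blockTableau_congr <;> omega

end Point

/-! ### Weights of points -/

theorem count_rep (a : Letter) (n : ℕ) (w : Word) : (rep n w).count a = n * w.count a := by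
  induction n with
  | zero => simp [rep]
  | succ n ih => rw [rep_succ, List.count_append, ih]; ring

theorem wordWeight_blockWord (A B C D E p q r s : ℕ) :
    wordWeight (blockWord A B C D E p q r s) =
      ((p - q + r - s + 2 * B - 2 * D : ℤ), (q - r + A - B + D - E : ℤ)) := by
  simp only [wordWeight, blockWord, List.count_append, count_rep, Prod.mk.injEq]
  constructor
  · simp
    ring
  · simp
    ring

namespace Point

def weight (P : Point) : ℤ × ℤ :=
  (2 * P.r - P.R + P.Q + 2 * P.K - 2 * P.x, P.A - P.E - P.K + P.x - P.r)

theorem weight_tableau {l m : ℕ} {P : Point} (h : P.Valid l m) : P.tableau.weight = P.weight := by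
  obtain ⟨h1, h2, h3, h4, h5⟩ := h
  rw [Tableau.weight, word_tableau, word, wordWeight_blockWord, weight, Prod.mk.injEq]
  constructor <;> omega

/-! ### The preatoms in terms of points -/

/-- Membership in the principal preatom. -/
def Prim (P : Point) : Prop :=
  P.r = P.R ∨ P.x = P.Q + 2 * P.K ∨ P.Q = 0 ∧ (P.r = 0 ∨ P.x = 0)

theorem valid_phi {l m : ℕ} {P : Point} (h : P.Valid l m) : P.phi.Valid (l + 2) m := by
  obtain ⟨h1, h2, h3, h4, h5⟩ := h
  unfold phi
  split_ifs <;> constructor <;> dsimp only <;> omega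

theorem weight_phi (P : Point) : P.phi.weight = P.weight := by
  unfold phi weight
  split_ifs <;> rw [Prod.mk.injEq] <;> constructor <;> dsimp only <;> omega

theorem not_prim_phi {l m : ℕ} {P : Point} (h : P.Valid l m) : ¬ P.phi.Prim := by
  obtain ⟨h1, h2, h3, h4, h5⟩ := h
  unfold phi Prim
  split_ifs <;> dsimp only <;> simp only [false_and, or_false, and_false] <;> omega

theorem phi_injOn (l m : ℕ) : Set.InjOn phi {P | P.Valid l m} := by
  rintro ⟨R, Q, A, K, E, r, x⟩ ⟨h1, h2, h3, h4, h5⟩ ⟨R', Q', A', K', E', r', x'⟩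
    ⟨k1, k2, k3, k4, k5⟩ e
  simp only [phi] at *
  split_ifs at e <;> simp only [mk.injEq] at * <;> omega

/-- The value of `Q` reveals the branch of `phi`: `Q > 0` comes from `E = 0`, and `Q = 0` from `E >
0`. -/
theorem exists_phi_eq {l m : ℕ} {P : Point} (h : P.Valid (l + 2) m) (hP : ¬ P.Prim) :
    ∃ P' : Point, P'.Valid l m ∧ P'.phi = P := by
  obtain ⟨R, Q, A, K, E, r, x⟩ := P
  obtain ⟨h1, h2, h3, h4, h5⟩ := h
  simp only [Prim] at *
  rcases Nat.eq_zero_or_pos Q with hQ | hQ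
  · refine ⟨⟨R - 2, Q, A, K - 1, E + 1, r - 1, x - 1⟩, ⟨?_, ?_, ?_, ?_, ?_⟩, ?_⟩
    iterate 5 (dsimp only; omega)
    simp only [phi, mk.injEq, Nat.succ_ne_zero, if_false, true_and]
    omega
  · refine ⟨⟨R - 1, Q - 1, A, K, E, r, x⟩, ⟨?_, ?_, ?_, ?_, ?_⟩, ?_⟩
    iterate 5 (dsimp only; omega)
    have : E = 0 := by omega
    simp only [phi, mk.injEq, this, if_true, and_true]
    omega

theorem Phi_image (l m : ℕ) (s : Set Point) (hs : s ⊆ {P | P.Valid l m}) :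
    Tableau.Phi '' (tableau '' s) = tableau '' (phi '' s) := by
  rw [Set.image_image, Set.image_image]
  exact Set.image_congr fun P hP => Phi_tableau (hs hP)

theorem phi_image_valid (l m : ℕ) :
    phi '' {P | P.Valid l m} = {P | P.Valid (l + 2) m ∧ ¬ P.Prim} := by
  ext P
  constructor
  · rintro ⟨P, hP, rfl⟩
    exact ⟨valid_phi hP, not_prim_phi hP⟩
  · rintro ⟨h, h'⟩
    exact exists_phi_eq h h'

theorem preatom_eq (l m : ℕ) : preatom l m = tableau '' {P | P.Valid l m ∧ P.Prim} := by
  match l with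
  | 0 =>
    rw [preatom, crystal_eq]
    congr 1
    ext P
    refine ⟨fun h => ⟨h, ?_⟩, fun h => h.1⟩
    obtain ⟨h1, h2, h3, h4, h5⟩ := h
    exact Or.inl (by omega)
  | 1 =>
    rw [preatom, crystal_eq]
    congr 1
    ext P
    refine ⟨fun h => ⟨h, ?_⟩, fun h => h.1⟩
    obtain ⟨h1, h2, h3, h4, h5⟩ := h
    unfold Prim
    omega
  | l + 2 =>
    rw [preatom, crystal_eq, crystal_eq, Phi_image l m _ subset_rfl, phi_image_valid,
      ← Set.InjOn.image_sdiff_subset (tableau_injOn (l + 2) m) (fun P hP => hP.1)]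
    congr 1
    ext P
    simp only [Set.mem_sdiff, Set.mem_ofPred_eq, not_and, not_not]
    exact ⟨fun h => ⟨h.1, h.2 h.1⟩, fun h => ⟨h.1, fun _ => h.2⟩⟩

/-! ### The maps `Ψ` and `Ψ̄` on points -/

/-- Since `d = R - r` and `l = R + Q`, the first test is `d = 0 ∨ d = l`. For a point satisfying
`Prim`, the last two branches have `x = Q + 2K`. -/
def psi (P : Point) : Point :=
  if P.r = P.R ∨ P.Q = 0 ∧ P.r = 0 then { P with K := P.K + 1, x := P.x + 1 }
  else if P.Q = 0 ∧ P.x = 0 then { P with K := P.K + 1, r := P.r - 1 }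
  else if P.Q = 0 then { P with A := P.A + 1, K := P.K - 1, E := P.E + 1, r := P.r - 1, x := P.x - 2 }
  else { P with R := P.R + 1, Q := P.Q - 1, A := P.A + 1, x := P.x - 1 }

/-- With `N = Q + 2K`: increasing `K` lengthens the second string by 2, and the accompanying shift
of `x` or `r` pushes a string into the interior of a longer one. The branches that increase `A`
change `(R, N)` to `(R + 1, N - 1)` or `(R, N - 2)` and, for `R ≤ N`, keep ends of strings at ends.
Unlike in `psi`, top ends with `r = R > x` are treated as mirror images of bottom ends with `x = N`.
-/
def psiBar (P : Point) : Point :=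
  if P.r = P.R ∧ P.R ≤ P.x ∨ P.Q = 0 ∧ P.r = 0 then { P with K := P.K + 1, x := P.x + 1 }
  else if P.Q = 0 ∧ P.x = 0 then { P with K := P.K + 1, r := P.r - 1 }
  else if P.x = P.Q + 2 * P.K then
    if P.Q = 0 then
      { P with A := P.A + 1, K := P.K - 1, E := P.E + 1, r := P.r - 1, x := P.x - 2 }
    else { P with R := P.R + 1, Q := P.Q - 1, A := P.A + 1, x := P.x - 1 }
  else
    if P.Q = 0 then { P with A := P.A + 1, K := P.K - 1, E := P.E + 1, x := P.x - 1 }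
    else { P with R := P.R + 1, Q := P.Q - 1, A := P.A + 1, r := P.r + 1 }

variable {l m : ℕ} {P P' : Point}

theorem valid_psi (h : P.Valid l m) (hP : P.Prim) : P.psi.Valid l (m + 1) := by
  obtain ⟨h1, h2, h3, h4, h5⟩ := h
  unfold Prim at hP
  unfold psi
  split_ifs <;> constructor <;> dsimp only <;> omega

theorem prim_psi (h : P.Valid l m) (hP : P.Prim) : P.psi.Prim := by
  obtain ⟨h1, h2, h3, h4, h5⟩ := h
  unfold Prim at hP ⊢
  unfold psi
  split_ifs <;> dsimp only <;> omega

theorem str2_psi (h : P.Valid l m) (hP : P.Prim) (a b c d : ℕ)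
    (hs : P.tableau.str2 = (a, b, c, d)) :
    P.psi.tableau.str2 =
      if d = 0 ∨ d = l then (a, b + 1, c + 1, d) else (a, b, c + 1, d + 1) := by
  have hv := valid_psi h hP
  rw [str2_tableau h] at hs
  rw [str2_tableau hv]
  obtain ⟨R, Q, A, K, E, r, x⟩ := P
  obtain ⟨h1, h2, h3, h4, h5⟩ := h
  simp only [Prod.mk.injEq, Prim] at hs hP h1 h2 h3 h4 h5
  obtain ⟨rfl, rfl, rfl, rfl⟩ := hs
  have hc : (R - r = 0 ∨ R - r = l) ↔ (r = R ∨ Q = 0 ∧ r = 0) := by omega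
  simp only [hc]
  unfold psi
  dsimp only
  split_ifs with c1 c2 c3 <;> simp only [Prod.mk.injEq, true_and, and_true]
  · clear hP h3 h1 h2 hc hv; omega
  · clear hP h3 h1 h2 hc hv; omega
  · have : x = Q + 2 * K := by omega
    clear hP h3 h2 hc hv; omega
  · have : x = Q + 2 * K := by omega
    have : E = 0 := by omega
    clear hP h3 h2 hc hv; omega

theorem valid_psiBar (h : P.Valid l m) (hP : P.Prim) : P.psiBar.Valid l (m + 1) := by
  obtain ⟨h1, h2, h3, h4, h5⟩ := h
  unfold Prim at hP
  unfold psiBar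
  split_ifs <;> constructor <;> dsimp only <;> omega

theorem prim_psiBar (h : P.Valid l m) (hP : P.Prim) : P.psiBar.Prim := by
  obtain ⟨h1, h2, h3, h4, h5⟩ := h
  unfold Prim at hP ⊢
  unfold psiBar
  split_ifs <;> dsimp only <;> omega

theorem weight_psiBar (h : P.Valid l m) (hP : P.Prim) : P.psiBar.weight = P.weight := by
  obtain ⟨h1, h2, h3, h4, h5⟩ := h
  unfold Prim at hP
  unfold psiBar weight
  split_ifs <;> rw [Prod.mk.injEq] <;> constructor <;> dsimp only <;> omega

/-- The definitions can differ only for `r = R > x`. A nonpositive first weight coordinate with `r =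
R` gives `2x ≥ R + (Q + 2K) ≥ R + x`, hence `x ≥ R`. -/
theorem psiBar_eq_psi (h : P.Valid l m) (hP : P.Prim) (hw : P.weight.1 ≤ 0) :
    P.psiBar = P.psi := by
  obtain ⟨h1, h2, h3, h4, h5⟩ := h
  unfold Prim at hP
  simp only [weight] at hw
  unfold psiBar psi
  split_ifs <;> simp only [mk.injEq] <;> omega

def refl (P : Point) : Point :=
  if P.Q + 2 * P.K + P.r ≤ P.R + P.x then
    { P with r := P.R + P.x + min P.r P.x - (P.Q + 2 * P.K + P.r), x := min P.r P.x }
  else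
    { P with r := min P.r P.x, x := P.Q + 2 * P.K + P.r + min P.r P.x - (P.R + P.x) }

theorem isRefl_refl (h : P.Valid l m) : P.IsRefl P.refl := by
  obtain ⟨h1, h2, h3, h4, h5⟩ := h
  unfold refl
  split_ifs <;> constructor <;> dsimp only <;> omega

theorem valid_refl (h : P.Valid l m) : P.refl.Valid l m := by
  obtain ⟨h1, h2, h3, h4, h5⟩ := h
  unfold refl
  split_ifs <;> constructor <;> dsimp only <;> omega

/-- With `N = Q + 2K`, the 1-string `min r x = k` runs from `(r, x) = (R, k)` through `(k, k)` to
`(k, N)`. Thus `Prim` selects the two ends of every string, the whole shortest string `k = min R N`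
and, if `Q = 0`, the whole longest string `k = 0`; each of these sets is symmetric. -/
theorem IsRefl.prim (h : P.Valid l m) (h' : P'.Valid l m) (hP : P.IsRefl P') (hp : P.Prim) :
    P'.Prim := by
  obtain ⟨h1, h2, h3, h4, h5⟩ := h
  obtain ⟨k1, k2, k3, k4, k5⟩ := h'
  obtain ⟨R, Q, A, K, E, r, x⟩ := P
  obtain ⟨R', Q', A', K', E', r', x'⟩ := P'
  obtain ⟨rfl, rfl, rfl, rfl, rfl, g1, g2⟩ := hP
  simp only [Prim] at *
  omega

theorem IsRefl.weight_fst (hP : P.IsRefl P') : P'.weight.1 = - P.weight.1 := by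
  obtain ⟨R, Q, A, K, E, r, x⟩ := P
  obtain ⟨R', Q', A', K', E', r', x'⟩ := P'
  obtain ⟨rfl, rfl, rfl, rfl, rfl, g1, g2⟩ := hP
  simp only [weight] at *
  omega

/-- The branches with guards simplified by `Prim`, in a form that lets two points be compared branch
by branch by linear arithmetic. -/
theorem psiBar_cases (h : P.Valid l m) (hP : P.Prim) :
    (P.r = P.R ∧ P.R ≤ P.x ∧ P.psiBar = { P with K := P.K + 1, x := P.x + 1 }) ∨
    (P.r < P.R ∧ P.Q = 0 ∧ P.r = 0 ∧ P.psiBar = { P with K := P.K + 1, x := P.x + 1 }) ∨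
    (P.Q = 0 ∧ P.x = 0 ∧ 0 < P.r ∧ P.psiBar = { P with K := P.K + 1, r := P.r - 1 }) ∨
    (P.Q = 0 ∧ 0 < P.x ∧ 0 < P.r ∧ P.x = P.Q + 2 * P.K ∧ (P.r < P.R ∨ P.x < P.R) ∧
      P.psiBar =
        { P with A := P.A + 1, K := P.K - 1, E := P.E + 1, r := P.r - 1, x := P.x - 2 }) ∨
    (0 < P.Q ∧ P.x = P.Q + 2 * P.K ∧ (P.r < P.R ∨ P.x < P.R) ∧
      P.psiBar = { P with R := P.R + 1, Q := P.Q - 1, A := P.A + 1, x := P.x - 1 }) ∨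
    (P.Q = 0 ∧ 0 < P.x ∧ P.r = P.R ∧ P.x < P.R ∧ P.x < P.Q + 2 * P.K ∧
      P.psiBar = { P with A := P.A + 1, K := P.K - 1, E := P.E + 1, x := P.x - 1 }) ∨
    (0 < P.Q ∧ P.r = P.R ∧ P.x < P.R ∧ P.x < P.Q + 2 * P.K ∧
      P.psiBar = { P with R := P.R + 1, Q := P.Q - 1, A := P.A + 1, r := P.r + 1 }) := by
  obtain ⟨-, -, -, h4, h5⟩ := h
  unfold Prim at hP
  by_cases c1 : P.r = P.R ∧ P.R ≤ P.x
  · exact Or.inl ⟨c1.1, c1.2, if_pos (Or.inl c1)⟩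
  refine Or.inr ?_
  by_cases c2 : P.Q = 0 ∧ P.r = 0
  · exact Or.inl ⟨by omega, c2.1, c2.2, if_pos (Or.inr c2)⟩
  refine Or.inr ?_
  have c3 : ¬ (P.r = P.R ∧ P.R ≤ P.x ∨ P.Q = 0 ∧ P.r = 0) := not_or.2 ⟨c1, c2⟩
  by_cases c4 : P.Q = 0 ∧ P.x = 0
  · exact Or.inl ⟨c4.1, c4.2, by omega, by rw [psiBar, if_neg c3, if_pos c4]⟩
  refine Or.inr ?_
  by_cases c5 : P.x = P.Q + 2 * P.K
  · by_cases c6 : P.Q = 0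
    · exact Or.inl ⟨c6, by omega, by omega, c5, by omega,
        by rw [psiBar, if_neg c3, if_neg c4, if_pos c5, if_pos c6]⟩
    · exact Or.inr (Or.inl ⟨by omega, c5, by omega,
        by rw [psiBar, if_neg c3, if_neg c4, if_pos c5, if_neg c6]⟩)
  · refine Or.inr (Or.inr ?_)
    by_cases c6 : P.Q = 0
    · exact Or.inl ⟨c6, by omega, by omega, by omega, by omega,
        by rw [psiBar, if_neg c3, if_neg c4, if_neg c5, if_pos c6]⟩
    · exact Or.inr ⟨by omega, by omega, by omega, by omega,
        by rw [psiBar, if_neg c3, if_neg c4, if_neg c5, if_neg c6]⟩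

/-- A point and its mirror image fall in the same branch or in one of the pairs second/third,
fourth/sixth, fifth/seventh; all other combinations contradict the equality of `Q` and of `min r x`.
-/
theorem IsRefl.psiBar (h : P.Valid l m) (h' : P'.Valid l m) (hP : P.IsRefl P') (hp : P.Prim) :
    P.psiBar.IsRefl P'.psiBar := by
  have c := psiBar_cases h hp
  have c' := psiBar_cases h' (hP.prim h h' hp)
  obtain ⟨-, -, -, h4, h5⟩ := h
  obtain ⟨-, -, -, k4, k5⟩ := h'
  clear hp
  generalize P.psiBar = S at *
  generalize P'.psiBar = S' at *
  obtain ⟨R, Q, A, K, E, r, x⟩ := P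
  obtain ⟨R', Q', A', K', E', r', x'⟩ := P'
  obtain ⟨rfl, rfl, rfl, rfl, rfl, g1, g2⟩ := hP
  dsimp only at *
  rcases c with ⟨c1, c2, rfl⟩ | ⟨c0, c1, c2, rfl⟩ | ⟨c1, c2, c3, rfl⟩ | ⟨c1, c2, c3, c4, c5, rfl⟩ |
    ⟨c1, c2, c3, rfl⟩ | ⟨c1, c2, c3, c4, c5, rfl⟩ | ⟨c1, c2, c3, c4, rfl⟩ <;>
  rcases c' with ⟨d1, d2, rfl⟩ | ⟨d0, d1, d2, rfl⟩ | ⟨d1, d2, d3, rfl⟩ | ⟨d1, d2, d3, d4, d5, rfl⟩ |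
    ⟨d1, d2, d3, rfl⟩ | ⟨d1, d2, d3, d4, d5, rfl⟩ | ⟨d1, d2, d3, d4, rfl⟩ <;>
  first
    | (exfalso; omega)
    | exact ⟨rfl, rfl, rfl, rfl, rfl, by dsimp only; omega, by dsimp only; omega⟩

theorem psiBar_injOn (l m : ℕ) : Set.InjOn psiBar {P | P.Valid l m ∧ P.Prim} := by
  rintro P ⟨h, hp⟩ P' ⟨h', hp'⟩ e
  have c := psiBar_cases h hp
  have c' := psiBar_cases h' hp'
  rw [e] at c
  obtain ⟨h1, h2, h3, h4, h5⟩ := h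
  obtain ⟨k1, k2, k3, k4, k5⟩ := h'
  clear hp hp' e
  generalize P'.psiBar = S at *
  obtain ⟨R, Q, A, K, E, r, x⟩ := P
  obtain ⟨R', Q', A', K', E', r', x'⟩ := P'
  simp only [mk.injEq] at *
  rcases c with ⟨c1, c2, rfl⟩ | ⟨c0, c1, c2, rfl⟩ | ⟨c1, c2, c3, rfl⟩ | ⟨c1, c2, c3, c4, c5, rfl⟩ |
    ⟨c1, c2, c3, rfl⟩ | ⟨c1, c2, c3, c4, c5, rfl⟩ | ⟨c1, c2, c3, c4, rfl⟩ <;>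
  simp only [mk.injEq] at c' <;>
  rcases c' with ⟨d1, d2, d3⟩ | ⟨d0, d1, d2, d3⟩ | ⟨d1, d2, d3, d4⟩ | ⟨d1, d2, d3, d4, d5, d6⟩ |
    ⟨d1, d2, d3, d4⟩ | ⟨d1, d2, d3, d4, d5, d6⟩ | ⟨d1, d2, d3, d4, d5⟩ <;>
  omega

end Point

/-- `ν` lies in `μ + ℤΦ` and in the octagon spanned by the orbit of `μ = l ϖ₁ + m ϖ₂`. -/
structure InOctagon (l m : ℕ) (ν : ℤ × ℤ) : Prop where
  parity : 2 ∣ ν.1 - l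
  h1 : ν.1 ≤ l + 2 * m
  h2 : -(l + 2 * m : ℤ) ≤ ν.1
  h3 : ν.1 + 2 * ν.2 ≤ l + 2 * m
  h4 : -(l + 2 * m : ℤ) ≤ ν.1 + 2 * ν.2
  h5 : ν.2 ≤ l + m
  h6 : -(l + m : ℤ) ≤ ν.2
  h7 : ν.1 + ν.2 ≤ l + m
  h8 : -(l + m : ℤ) ≤ ν.1 + ν.2

/-! ### Complements of the images of `psiBar` and their weights. -/

namespace Point

variable {l m : ℕ} {P P' : Point}

theorem inOctagon_weight (h : P.Valid l m) : InOctagon l m P.weight := by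
  obtain ⟨h1, h2, h3, h4, h5⟩ := h
  constructor <;> simp only [weight] <;> omega

/-- The points outside of the image of `Ψ̄`. -/
def Atomic (P : Point) : Prop :=
  (P.A = 0 ∧ P.x = P.Q + 2 * P.K) ∨ (P.A = 0 ∧ P.r = P.R ∧ P.x ≤ P.R) ∨
  (0 < P.A ∧ P.r = P.R ∧ P.R ≤ P.x ∧ P.K = 0) ∨ (0 < P.A ∧ P.r = P.R ∧ P.R = P.x) ∨
  (0 < P.A ∧ P.r = P.R ∧ P.R ≤ P.x ∧ P.x = P.Q + 2 * P.K) ∨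
  (0 < P.A ∧ P.r = P.R ∧ P.x + 1 = P.R) ∨
  (0 < P.A ∧ P.r + 1 = P.R ∧ P.R ≤ P.x + 2 ∧ P.x = P.Q + 2 * P.K)

theorem not_atomic_psiBar (hl : l ≠ 0) (h : P.Valid l m) (hP : P.Prim) : ¬ P.psiBar.Atomic := by
  have c := psiBar_cases h hP
  obtain ⟨h1, h2, h3, h4, h5⟩ := h
  unfold Atomic
  rcases c with ⟨c1, c2, e⟩ | ⟨c0, c1, c2, e⟩ | ⟨c1, c2, c3, e⟩ | ⟨c1, c2, c3, c4, c5, e⟩ |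
    ⟨c1, c2, c3, e⟩ | ⟨c1, c2, c3, c4, c5, e⟩ | ⟨c1, c2, c3, c4, e⟩ <;> rw [e] <;> dsimp only <;>
  rintro (d | d | d | d | d | d | d) <;> omega

/-- The alternatives correspond to the ways of inverting `psiBar`: undo a step with `x`, undo a step
with `r`, move back with `x = Q + 2K`, move back a top end. -/
theorem cases_of_not_atomic (hl : l ≠ 0) (h : P.Valid l (m + 1)) (hP : P.Prim)
    (ha : ¬ P.Atomic) :
    (0 < P.K ∧ 0 < P.x ∧ P.x < P.Q + 2 * P.K ∧
        (P.r = P.R ∧ P.R < P.x ∨ P.Q = 0 ∧ P.r = 0 ∧ P.r < P.R)) ∨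
      (P.Q = 0 ∧ P.x = 0 ∧ P.r < P.R ∧ 0 < P.K) ∨
      (0 < P.A ∧ P.x = P.Q + 2 * P.K ∧ P.r < P.R ∧ (P.r + 1 < P.R ∨ P.x + 2 < P.R)) ∨
      (0 < P.A ∧ P.r = P.R ∧ P.x + 1 < P.R) := by
  obtain ⟨h1, h2, h3, h4, h5⟩ := h
  obtain ⟨R, Q, A, K, E, r, x⟩ := P
  simp only [Prim, Atomic, not_or, not_and] at *
  obtain ⟨a1, a2, a3, a4, a5, a6, a7⟩ := ha
  rcases Nat.eq_zero_or_pos A with hA | hA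
  · have b1 := a1 hA
    have b2 := a2 hA
    clear a1 a2 a3 a4 a5 a6 a7
    rcases hP with hP | hP | ⟨hP, hP' | hP'⟩
    · have := b2 hP
      exact Or.inl (by omega)
    · exact absurd hP b1
    · clear b2
      by_cases hx0 : x = 0
      · exact Or.inr (Or.inl (by omega))
      · exact Or.inl (by omega)
    · have : r ≠ R := fun hr => b2 hr (by omega)
      exact Or.inr (Or.inl (by omega))
  · have b3 := a3 hA
    have b4 := a4 hA
    have b5 := a5 hA
    have b6 := a6 hA
    have b7 := a7 hA
    clear a1 a2 a3 a4 a5 a6 a7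
    by_cases hr : r = R
    · have c4 := b4 hr
      have c6 := b6 hr
      by_cases hx : R ≤ x
      · have c3 := b3 hr hx
        have c5 := b5 hr hx
        clear b3 b4 b5 b6 b7 hP
        exact Or.inl (by omega)
      · exact Or.inr (Or.inr (Or.inr (by omega)))
    · clear b3 b4 b5 b6
      by_cases hx : x = Q + 2 * K
      · refine Or.inr (Or.inr (Or.inl ⟨hA, hx, by omega, ?_⟩))
        clear hP
        by_contra hc
        exact b7 (by omega) (by omega) hx
      · clear b7
        rcases hP with hP | hP | ⟨hP, hP' | hP'⟩
        · exact absurd hP hr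
        · exact absurd hP hx
        · by_cases hx0 : x = 0
          · exact Or.inr (Or.inl (by omega))
          · exact Or.inl (by omega)
        · exact Or.inr (Or.inl (by omega))

theorem exists_psiBar_eq (hl : l ≠ 0) (h : P.Valid l (m + 1)) (hP : P.Prim) (ha : ¬ P.Atomic) :
    ∃ P' : Point, P'.Valid l m ∧ P'.Prim ∧ P'.psiBar = P := by
  have hc := cases_of_not_atomic hl h hP ha
  clear hP ha
  obtain ⟨h1, h2, h3, h4, h5⟩ := h
  obtain ⟨R, Q, A, K, E, r, x⟩ := P
  dsimp only at *
  rcases hc with ⟨c1, c2, c3, c4⟩ | ⟨c1, c2, c3, c4⟩ | ⟨c1, c2, c3, c4⟩ | ⟨c1, c2, c3⟩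
  · refine ⟨⟨R, Q, A, K - 1, E, r, x - 1⟩, ⟨?_, ?_, ?_, ?_, ?_⟩, ?_, ?_⟩
    iterate 5 (dsimp only; omega)
    · simp only [Prim]; omega
    · rw [psiBar, if_pos]
      · simp only [mk.injEq, true_and, and_true]; omega
      · dsimp only; omega
  · refine ⟨⟨R, Q, A, K - 1, E, r + 1, x⟩, ⟨?_, ?_, ?_, ?_, ?_⟩, ?_, ?_⟩
    iterate 5 (dsimp only; omega)
    · simp only [Prim]; omega
    · rw [psiBar, if_neg, if_pos]
      · simp only [mk.injEq, true_and, and_true]; omega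
      · dsimp only; omega
      · dsimp only; omega
  -- The branches with `Q = 0` increase `E`, and those with `Q > 0` leave `E = 0`; so `E` decides
  -- which one to undo.
  · rcases Nat.eq_zero_or_pos E with hE | hE
    · refine ⟨⟨R - 1, Q + 1, A - 1, K, E, r, x + 1⟩, ⟨?_, ?_, ?_, ?_, ?_⟩, ?_, ?_⟩
      iterate 5 (dsimp only; omega)
      · simp only [Prim]; omega
      · rw [psiBar, if_neg, if_neg, if_pos, if_neg]
        · simp only [mk.injEq, true_and, and_true]; omega
        all_goals dsimp only; omega
    · refine ⟨⟨R, Q, A - 1, K + 1, E - 1, r + 1, x + 2⟩, ⟨?_, ?_, ?_, ?_, ?_⟩, ?_, ?_⟩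
      iterate 5 (dsimp only; omega)
      · simp only [Prim]; omega
      · rw [psiBar, if_neg, if_neg, if_pos, if_pos]
        · simp only [mk.injEq, true_and, and_true]; omega
        all_goals dsimp only; omega
  · rcases Nat.eq_zero_or_pos E with hE | hE
    · refine ⟨⟨R - 1, Q + 1, A - 1, K, E, r - 1, x⟩, ⟨?_, ?_, ?_, ?_, ?_⟩, ?_, ?_⟩
      iterate 5 (dsimp only; omega)
      · simp only [Prim]; omega
      · rw [psiBar, if_neg, if_neg, if_neg, if_neg]
        · simp only [mk.injEq, true_and, and_true]; omega
        all_goals dsimp only; omega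
    · refine ⟨⟨R, Q, A - 1, K + 1, E - 1, r, x + 1⟩, ⟨?_, ?_, ?_, ?_, ?_⟩, ?_, ?_⟩
      iterate 5 (dsimp only; omega)
      · simp only [Prim]; omega
      · rw [psiBar, if_neg, if_neg, if_neg, if_pos]
        · simp only [mk.injEq, true_and, and_true]; omega
        all_goals dsimp only; omega

set_option maxHeartbeats 8000000 in
theorem Atomic.eq_of_weight_eq (h : P.Valid l m) (h' : P'.Valid l m) (ha : P.Atomic)
    (ha' : P'.Atomic) (hw : P.weight = P'.weight) : P = P' := by
  obtain ⟨h1, h2, h3, h4, h5⟩ := h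
  obtain ⟨k1, k2, k3, k4, k5⟩ := h'
  obtain ⟨R, Q, A, K, E, r, x⟩ := P
  obtain ⟨R', Q', A', K', E', r', x'⟩ := P'
  simp only [weight, Prod.mk.injEq, Atomic, mk.injEq] at *
  obtain ⟨w1, w2⟩ := hw
  -- This is `ν₁ + 2ν₂`, the invariant of 1-strings: both points lie over the same line of weights.
  have hh : (Q : ℤ) - R + 2 * A - 2 * E = Q' - R' + 2 * A' - 2 * E' := by omega
  suffices hs : R = R' ∧ E = E' ∧ r = r' by omega
  rcases h3 with rfl | rfl <;> rcases k3 with rfl | rfl <;>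
  rcases ha with d | d | d | d | d | d | d <;>
  rcases ha' with e | e | e | e | e | e | e <;> omega

theorem weight_mk (R Q A K E r x : ℕ) : weight ⟨R, Q, A, K, E, r, x⟩ =
    ((2 * r - R + Q + 2 * K - 2 * x : ℤ), (A - E - K + x - r : ℤ)) := rfl

theorem valid_mk {l m R Q A K E r x : ℕ} (hl : R + Q = l) (hm : A + K + E = m)
    (hE : E = 0 ∨ Q = 0) (hr : r ≤ R) (hx : x ≤ Q + 2 * K) :
    Valid l m ⟨R, Q, A, K, E, r, x⟩ :=
  ⟨hl, hm, hE, hr, hx⟩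

/-- Existence of a point with prescribed weight in the part `0 < A` of an atom. -/
theorem exists_atomic_of_pos {l m : ℕ} (hl : l ≠ 0) {ν : ℤ × ℤ} (hν : InOctagon l m ν) {g : ℤ}
    {n : ℕ} (hn : ν.1 = n ∨ ν.1 = -n) (hg : ν.1 + 2 * ν.2 = l + 2 * g)
    (hpos : 0 < g ∨ n < l + 2 * g + 2 * m) (hm : 0 < m)
    (h3 : n ≤ l + 2 * m - 2 * g) :
    ∃ P : Point, P.Valid l m ∧ P.Prim ∧ P.Atomic ∧ P.weight = ν := by
  obtain ⟨ν1, ν2⟩ := ν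
  obtain ⟨p, p1, p2, p3, p4, p5, p6, p7, p8⟩ := hν
  dsimp only at *
  -- Here `g = A - R - E`. In this range the component `K = E = 0`, `A = m` is used, where the whole
  -- shortest string is available.
  by_cases hw : (2 * m : ℤ) ≤ l + 2 * g - n
  · obtain ⟨x, hx⟩ : ∃ x : ℕ, 2 * (x : ℤ) = l - ν1 := ⟨((l - ν1) / 2).toNat, by omega⟩
    obtain ⟨R, hR⟩ : ∃ R : ℕ, (R : ℤ) = m - g := ⟨(m - g).toNat, by omega⟩
    refine ⟨⟨R, l - R, m, 0, 0, R, x⟩,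
        valid_mk (by omega) (by omega) (by omega) (by omega) (by omega), ?_, ?_, ?_⟩
    · exact Or.inl rfl
    · exact Or.inr (Or.inr (Or.inl ⟨hm, rfl, by dsimp only; omega, rfl⟩))
    · rw [weight_mk, Prod.mk.injEq]; constructor <;> omega
  -- For fixed `g` a component is determined by `t = R + E`, and its two strings satisfy `Q + 2K - R
  -- = l + 2m - 2g - 4t`. The ends of its shortest string realise this value of `|ν₁|`, those of the
  -- next string the value plus 2; hence the split by the parity of `d`.
  · obtain ⟨d, hd⟩ : ∃ d : ℕ, 2 * (d : ℤ) = l + 2 * m - 2 * g - n :=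
      ⟨((l + 2 * m - 2 * g - n) / 2).toNat, by omega⟩
    obtain ⟨t, ht⟩ := Nat.even_or_odd' d
    rcases ht with ht | ht
    · obtain ⟨A, hA⟩ : ∃ A : ℕ, (A : ℤ) = g + t := ⟨(g + t).toNat, by omega⟩
      -- `E = 0 ∨ Q = 0` forces `R` to be filled up to `l` before `E` becomes positive.
      obtain ⟨R, E, hRE, hR, hE⟩ : ∃ R E : ℕ, R + E = t ∧ R ≤ l ∧ (E = 0 ∨ R = l) :=
        ⟨min t l, t - l, by omega, by omega, by omega⟩
      obtain ⟨K, hK⟩ : ∃ K : ℕ, A + K + E = m := ⟨m - A - E, by rcases hE with hE | hE <;> omega⟩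
      have hA0 : 0 < A := by omega
      have hN : (l - R : ℕ) + 2 * K = R + n := by rcases hE with hE | hE <;> omega
      rcases hn with hn' | hn'
      · refine ⟨⟨R, l - R, A, K, E, R, R⟩,
          valid_mk (by omega) (by omega) (by omega) (by omega) (by omega), ?_, ?_, ?_⟩
        · exact Or.inl rfl
        · exact Or.inr (Or.inr (Or.inr (Or.inl ⟨hA0, rfl, rfl⟩)))
        · rw [weight_mk, Prod.mk.injEq]; constructor <;> omega
      · refine ⟨⟨R, l - R, A, K, E, R, R + n⟩,
          valid_mk (by omega) (by omega) (by omega) (by omega) (by omega), ?_, ?_, ?_⟩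
        · exact Or.inl rfl
        · exact Or.inr (Or.inr (Or.inr (Or.inr (Or.inl ⟨hA0, rfl, Nat.le_add_right _ _, hN.symm⟩))))
        · rw [weight_mk, Prod.mk.injEq]; constructor <;> omega
    -- The component has index `t + 1`, and its first string is written with length `R + 1`.
    · obtain ⟨A, hA⟩ : ∃ A : ℕ, (A : ℤ) = g + (t + 1) := ⟨(g + (t + 1)).toNat, by omega⟩
      obtain ⟨R, E, hRE, hR, hE⟩ : ∃ R E : ℕ, R + 1 + E = t + 1 ∧ R + 1 ≤ l ∧ (E = 0 ∨ R + 1 = l) :=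
        ⟨min t (l - 1), t + 1 - l, by omega, by omega, by omega⟩
      obtain ⟨K, hK⟩ : ∃ K : ℕ, A + K + E = m := ⟨m - A - E, by rcases hE with hE | hE <;> omega⟩
      have hA0 : 0 < A := by omega
      have hN : (l - (R + 1) : ℕ) + 2 * K + 1 = R + n := by rcases hE with hE | hE <;> omega
      by_cases h0 : 0 < ν1
      · refine ⟨⟨R + 1, l - (R + 1), A, K, E, R + 1, R⟩,
          valid_mk (by omega) (by omega) (by omega) (by omega) (by omega), ?_, ?_, ?_⟩
        · exact Or.inl rfl
        · exact Or.inr (Or.inr (Or.inr (Or.inr (Or.inr (Or.inl ⟨hA0, rfl, rfl⟩)))))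
        · rw [weight_mk, Prod.mk.injEq]; constructor <;> omega
      · refine ⟨⟨R + 1, l - (R + 1), A, K, E, R, (l - (R + 1)) + 2 * K⟩,
          valid_mk (by omega) (by omega) (by omega) (by omega) (by omega),
          ?_, ?_, ?_⟩
        · exact Or.inr (Or.inl rfl)
        · exact Or.inr (Or.inr (Or.inr (Or.inr (Or.inr (Or.inr
            ⟨hA0, rfl, by dsimp only; omega, rfl⟩)))))
        · rw [weight_mk, Prod.mk.injEq]; constructor <;> omega

theorem exists_atomic {l m : ℕ} (hl : l ≠ 0) (hm : 0 < m) {ν : ℤ × ℤ} (hν : InOctagon l m ν) :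
    ∃ P : Point, P.Valid l m ∧ P.Prim ∧ P.Atomic ∧ P.weight = ν := by
  have hν' := hν
  obtain ⟨ν1, ν2⟩ := ν
  obtain ⟨p, p1, p2, p3, p4, p5, p6, p7, p8⟩ := hν
  dsimp only at *
  obtain ⟨g, hg⟩ : ∃ g : ℤ, ν1 + 2 * ν2 = l + 2 * g := ⟨(ν1 + 2 * ν2 - l) / 2, by omega⟩
  obtain ⟨n, hn⟩ : ∃ n : ℕ, ν1 = n ∨ ν1 = -n := ⟨ν1.natAbs, by omega⟩
  by_cases hpos : 0 < g
  · exact exists_atomic_of_pos hl hν' hn hg (Or.inl hpos) hm (by omega)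
  -- For `g ≤ 0` the line contains a component with `A = 0`, namely `R + E = -g`.
  obtain ⟨R, E, hRE, hR, hE⟩ : ∃ R E : ℕ, (R + E : ℤ) = -g ∧ R ≤ l ∧ (E = 0 ∨ R = l) :=
    ⟨min (-g).toNat l, (-g).toNat - l, by omega, by omega, by omega⟩
  obtain ⟨K, hK⟩ : ∃ K : ℕ, K + E = m := ⟨m - E, by omega⟩
  -- `j` is the number of steps from the top weight `l + 2K` of this component down to `|ν₁|`. The
  -- component misses the weight exactly when it lies strictly inside its shortest string and `R < Q
  -- + 2K`; components with `A > 0` then supply it.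
  obtain ⟨j, hj⟩ : ∃ j : ℕ, (2 * j : ℤ) = l + 2 * K - n :=
    ⟨((l + 2 * K - n) / 2 : ℤ).toNat, by rcases hE with hE | hE <;> omega⟩
  by_cases h1 : R < j ∧ R < l - R + 2 * K
  · refine exists_atomic_of_pos hl hν' hn hg (Or.inr ?_) hm ?_ <;>
      rcases hE with hE | hE <;> omega
  by_cases h2 : l - R + 2 * K < j
  · refine ⟨⟨R, l - R, 0, K, E, ((ν1 + l + 2 * K) / 2).toNat, l - R + 2 * K⟩,
      valid_mk (by omega) (by omega) (by omega) (by omega) (by omega), ?_, ?_, ?_⟩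
    · exact Or.inr (Or.inl rfl)
    · exact Or.inl ⟨rfl, rfl⟩
    · rw [weight_mk, Prod.mk.injEq]; constructor <;> omega
  · by_cases h0 : 0 < ν1
    · refine ⟨⟨R, l - R, 0, K, E, R, j⟩,
        valid_mk (by omega) (by omega) (by omega) (by omega) (by omega), ?_, ?_, ?_⟩
      · exact Or.inl rfl
      · exact Or.inr (Or.inl ⟨rfl, rfl, by dsimp only; omega⟩)
      · rw [weight_mk, Prod.mk.injEq]; constructor <;> omega
    · refine ⟨⟨R, l - R, 0, K, E, j, l - R + 2 * K⟩,
        valid_mk (by omega) (by omega) (by omega) (by omega) (by omega), ?_, ?_, ?_⟩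
      · exact Or.inr (Or.inl rfl)
      · exact Or.inl ⟨rfl, rfl⟩
      · rw [weight_mk, Prod.mk.injEq]; constructor <;> omega

/-- Existence for `m = 0`. -/
theorem exists_valid_zero {l : ℕ} {ν : ℤ × ℤ} (hν : InOctagon l 0 ν) :
    ∃ P : Point, P.Valid l 0 ∧ P.Prim ∧ P.weight = ν := by
  obtain ⟨ν1, ν2⟩ := ν
  obtain ⟨p, p1, p2, p3, p4, p5, p6, p7, p8⟩ := hν
  dsimp only at *
  obtain ⟨R, hR⟩ : ∃ R : ℕ, 2 * (R : ℤ) = l - (ν1 + 2 * ν2) :=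
    ⟨((l - (ν1 + 2 * ν2)) / 2).toNat, by omega⟩
  obtain ⟨x, hx⟩ : ∃ x : ℕ, 2 * (x : ℤ) = l - ν1 := ⟨((l - ν1) / 2).toNat, by omega⟩
  by_cases h : x ≤ l - R
  · refine ⟨⟨R, l - R, 0, 0, 0, R, x⟩,
      valid_mk (by omega) (by omega) (by omega) (by omega) (by omega), ?_, ?_⟩
    · exact Or.inl rfl
    · rw [weight_mk, Prod.mk.injEq]; constructor <;> omega
  · refine ⟨⟨R, l - R, 0, 0, 0, l - x, l - R⟩,
      valid_mk (by omega) (by omega) (by omega) (by omega) (by omega), ?_, ?_⟩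
    · exact Or.inr (Or.inl rfl)
    · rw [weight_mk, Prod.mk.injEq]; constructor <;> omega

theorem eq_of_weight_eq_zero {l : ℕ} {P P' : Point} (h : P.Valid l 0) (h' : P'.Valid l 0)
    (hP : P.Prim) (hP' : P'.Prim) (hw : P.weight = P'.weight) : P = P' := by
  obtain ⟨h1, h2, h3, h4, h5⟩ := h
  obtain ⟨k1, k2, k3, k4, k5⟩ := h'
  obtain ⟨R, Q, A, K, E, r, x⟩ := P
  obtain ⟨R', Q', A', K', E', r', x'⟩ := P'
  simp only [weight, Prod.mk.injEq, Prim, mk.injEq] at *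
  omega

theorem exists_valid_zero_one {ν : ℤ × ℤ} (hν : InOctagon 0 1 ν) :
    ∃ P : Point, P.Valid 0 1 ∧ P.weight = ν := by
  obtain ⟨ν1, ν2⟩ := ν
  obtain ⟨p, p1, p2, p3, p4, p5, p6, p7, p8⟩ := hν
  dsimp only at *
  by_cases h : ν1 + 2 * ν2 = 0
  · refine ⟨⟨0, 0, 0, 1, 0, 0, (1 - ν1 / 2).toNat⟩,
      valid_mk (by omega) (by omega) (by omega) (by omega) (by omega), ?_⟩
    rw [weight_mk, Prod.mk.injEq]; constructor <;> omega
  · refine ⟨⟨0, 0, (ν2 + 1).toNat / 2, 0, (1 - ν2).toNat / 2, 0, 0⟩,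
      valid_mk (by omega) (by omega) (by omega) (by omega) (by omega), ?_⟩
    rw [weight_mk, Prod.mk.injEq]; constructor <;> omega

theorem eq_of_weight_eq_zero_one {P P' : Point} (h : P.Valid 0 1) (h' : P'.Valid 0 1)
    (hw : P.weight = P'.weight) : P = P' := by
  obtain ⟨h1, h2, h3, h4, h5⟩ := h
  obtain ⟨k1, k2, k3, k4, k5⟩ := h'
  obtain ⟨R, Q, A, K, E, r, x⟩ := P
  obtain ⟨R', Q', A', K', E', r', x'⟩ := P'
  simp only [weight, Prod.mk.injEq, mk.injEq] at *
  omega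

/-- The points outside of the image of `Ψ̄²`, for `l = 0`. -/
def Atomic₀ (P : Point) : Prop := P.K ≤ 1 ∨ P.x ≤ 1 ∨ 2 * P.K ≤ P.x + 1

theorem psiBar_zero {m : ℕ} {P : Point} (h : P.Valid 0 m) :
    P.psiBar = { P with K := P.K + 1, x := P.x + 1 } := by
  obtain ⟨h1, h2, h3, h4, h5⟩ := h
  rw [psiBar, if_pos (by omega)]

theorem prim_zero {m : ℕ} {P : Point} (h : P.Valid 0 m) : P.Prim := by
  obtain ⟨h1, h2, h3, h4, h5⟩ := h
  exact Or.inl (by omega)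

/-- For `l = 0` the map only adds 1 to `K` and `x`. Removing its image once would leave only points
with `|K - x| = K` and lose the weights whose parity excludes this; subtracting 2 respects the
parity of `K`. -/
theorem atomic₀_iff {m : ℕ} {P : Point} (h : P.Valid 0 (m + 2)) :
    P.Atomic₀ ↔ ¬ ∃ P' : Point, P'.Valid 0 m ∧ P'.psiBar.psiBar = P := by
  have key {P' : Point} (h' : P'.Valid 0 m) :
      P'.psiBar.psiBar = { P' with K := P'.K + 2, x := P'.x + 2 } := by
    rw [psiBar_zero (valid_psiBar h' (prim_zero h')), psiBar_zero h']
  obtain ⟨h1, h2, h3, h4, h5⟩ := h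
  constructor
  · rintro ha ⟨P', h', rfl⟩
    rw [key h'] at ha
    obtain ⟨k1, k2, k3, k4, k5⟩ := h'
    simp only [Atomic₀] at ha
    omega
  · intro hn
    by_contra ha
    simp only [Atomic₀] at ha
    have hv : Valid 0 m { P with K := P.K - 2, x := P.x - 2 } := by
      constructor <;> dsimp only <;> omega
    refine hn ⟨_, hv, ?_⟩
    rw [key hv]
    ext <;> dsimp only <;> omega

theorem exists_atomic₀ {m : ℕ} {ν : ℤ × ℤ} (hν : InOctagon 0 m ν) :
    ∃ P : Point, P.Valid 0 m ∧ P.Atomic₀ ∧ P.weight = ν := by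
  obtain ⟨ν1, ν2⟩ := ν
  obtain ⟨p, p1, p2, p3, p4, p5, p6, p7, p8⟩ := hν
  dsimp only at *
  obtain ⟨d, hd⟩ : ∃ d : ℤ, ν1 = 2 * d := ⟨ν1 / 2, by omega⟩
  obtain ⟨e, he⟩ : ∃ e : ℤ, ν2 + d = e := ⟨_, rfl⟩
  -- The weight fixes `K - x = d` and `A - E = e`, hence the parity of `K`; the least admissible `K
  -- ≥ |d|` is taken.
  obtain ⟨K, hK, hK'⟩ : ∃ K : ℕ, (K = d.natAbs ∨ K = d.natAbs + 1) ∧ 2 ∣ m + e - K := by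
    by_cases h : 2 ∣ m + e - d.natAbs
    · exact ⟨_, Or.inl rfl, h⟩
    · exact ⟨_, Or.inr rfl, by omega⟩
  refine ⟨⟨0, 0, ((m + e - K) / 2).toNat, K, ((m - e - K) / 2).toNat, 0, (K - d).toNat⟩,
    valid_mk (by omega) (by omega) (by omega) (by omega) (by omega), ?_, ?_⟩
  · simp only [Atomic₀]; omega
  · rw [weight_mk, Prod.mk.injEq]; constructor <;> omega

theorem Atomic₀.eq_of_weight_eq {m : ℕ} {P P' : Point} (h : P.Valid 0 m) (h' : P'.Valid 0 m)
    (ha : P.Atomic₀) (ha' : P'.Atomic₀) (hw : P.weight = P'.weight) : P = P' := by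
  obtain ⟨h1, h2, h3, h4, h5⟩ := h
  obtain ⟨k1, k2, k3, k4, k5⟩ := h'
  obtain ⟨R, Q, A, K, E, r, x⟩ := P
  obtain ⟨R', Q', A', K', E', r', x'⟩ := P'
  simp only [weight, Prod.mk.injEq, Atomic₀, mk.injEq] at *
  omega

end Point

/-! ### The order on weights -/

theorem mem_rootLattice_iff (ν : ℤ × ℤ) : ν ∈ rootLattice ↔ 2 ∣ ν.1 := by
  rw [rootLattice, AddSubgroup.mem_closure_pair]
  constructor
  · rintro ⟨a, b, rfl⟩
    simp
  · rintro ⟨k, hk⟩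
    refine ⟨2 * k + ν.2, k + ν.2, Prod.ext ?_ ?_⟩ <;> simp <;> omega

theorem InOctagon.reflectWeight {l m : ℕ} {ν : ℤ × ℤ} (h : InOctagon l m ν) (i : Node) :
    InOctagon l m (reflectWeight i ν) := by
  obtain ⟨p, p1, p2, p3, p4, p5, p6, p7, p8⟩ := h
  cases i <;> constructor <;> simp [C2Crystal.reflectWeight] <;> omega

theorem inOctagon_toWeight (l m : ℕ) : InOctagon l m (DominantWeight.toWeight (l, m)) := by
  constructor <;> simp [DominantWeight.toWeight] <;> omega

theorem inOctagon_of_mem_weylOrbit {l m : ℕ} {ν : ℤ × ℤ}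
    (h : ν ∈ weylOrbit (DominantWeight.toWeight (l, m))) : InOctagon l m ν := by
  obtain ⟨is, rfl⟩ := h
  induction is with
  | nil => exact inOctagon_toWeight l m
  | cons i is ih => exact ih.reflectWeight i

theorem le_of_mem_convexHull {S : Set (ℝ × ℝ)} {α β c : ℝ} (h : ∀ p ∈ S, α * p.1 + β * p.2 ≤ c)
    {p : ℝ × ℝ} (hp : p ∈ convexHull ℝ S) : α * p.1 + β * p.2 ≤ c := by
  have hc : Convex ℝ {p : ℝ × ℝ | α * p.1 + β * p.2 ≤ c} := by
    intro x hx y hy a b ha hb hab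
    simp only [Set.mem_ofPred_eq, Prod.fst_add, Prod.snd_add, Prod.smul_fst, Prod.smul_snd,
      smul_eq_mul] at *
    calc α * (a * x.1 + b * y.1) + β * (a * x.2 + b * y.2)
        = a * (α * x.1 + β * x.2) + b * (α * y.1 + β * y.2) := by ring
      _ ≤ a * c + b * c := by gcongr
      _ = c := by rw [← add_mul, hab, one_mul]
  exact convexHull_min h hc hp

theorem _root_.Convex.mem_of_line {C : Set (ℝ × ℝ)} (hC : Convex ℝ C) {u v w : ℝ × ℝ} (d : ℝ × ℝ)
    (s t : ℝ) (hs : 0 ≤ s) (ht : 0 ≤ t) (hv : v ∈ C) (hw : w ∈ C) (ev : v = u - s • d)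
    (ew : w = u + t • d) : u ∈ C := by
  -- If `s + t = 0` the three points coincide and the barycentric coefficients would be `0 / 0`.
  rcases eq_or_lt_of_le (add_nonneg hs ht) with h | h
  · obtain rfl : s = 0 := by linarith
    simpa [ev] using hv
  · have := hC hv hw (a := t / (s + t)) (b := s / (s + t)) (by positivity) (by positivity)
      (by field_simp; ring)
    convert this using 1
    rw [ev, ew]
    ext <;> simp <;> field_simp <;> ring

/-- The octagon is cut at heights `±N`. Each point lies on a horizontal chord whose ends lie on
edges, and each end lies between two vertices. -/
theorem mem_convexHull_of_octagon {C : Set (ℝ × ℝ)} (hC : Convex ℝ C) {L N : ℝ} (hL : 0 ≤ L)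
    (hN : 0 ≤ N) (v1 : (L, N) ∈ C) (v2 : (-L, L + N) ∈ C) (v3 : (L + 2 * N, -N) ∈ C)
    (v4 : (-(L + 2 * N), L + N) ∈ C) (v5 : (L + 2 * N, -(L + N)) ∈ C) (v6 : (-(L + 2 * N), N) ∈ C)
    (v7 : (L, -(L + N)) ∈ C) (v8 : (-L, -N) ∈ C) {a b : ℝ}
    (h1 : a ≤ L + 2 * N) (h2 : -(L + 2 * N) ≤ a) (h3 : a + 2 * b ≤ L + 2 * N)
    (h4 : -(L + 2 * N) ≤ a + 2 * b) (h5 : b ≤ L + N) (h6 : -(L + N) ≤ b)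
    (h7 : a + b ≤ L + N) (h8 : -(L + N) ≤ a + b) : (a, b) ∈ C := by
  rcases le_total b N with hb | hb
  · rcases le_total (-N) b with hb' | hb'
    · have e1 : (L + N - b, b) ∈ C :=
        hC.mem_of_line (-1, 1) (b + N) (N - b) (by linarith) (by linarith) v3 v1
          (by ext <;> simp; ring) (by ext <;> simp)
      have e2 : (-(L + N) - b, b) ∈ C :=
        hC.mem_of_line (-1, 1) (b + N) (N - b) (by linarith) (by linarith) v8 v6
          (by ext <;> simp; ring) (by ext <;> simp; ring)
      exact hC.mem_of_line (1, 0) (a + b + (L + N)) (L + N - (a + b)) (by linarith) (by linarith)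
        e2 e1 (by ext <;> simp; ring) (by ext <;> simp; ring)
    · have e1 : (L + 2 * N, b) ∈ C :=
        hC.mem_of_line (0, 1) (b + (L + N)) (-N - b) (by linarith) (by linarith) v5 v3
          (by ext <;> simp) (by ext <;> simp)
      have e2 : (-(L + 2 * N) - 2 * b, b) ∈ C :=
        hC.mem_of_line (-2, 1) (b + (L + N)) (-N - b) (by linarith) (by linarith) v7 v8
          (by ext <;> simp; ring) (by ext <;> simp; ring)
      exact hC.mem_of_line (1, 0) (a + 2 * b + (L + 2 * N)) (L + 2 * N - a) (by linarith)
        (by linarith) e2 e1 (by ext <;> simp; ring) (by ext <;> simp)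
  · have e1 : (L + 2 * N - 2 * b, b) ∈ C :=
      hC.mem_of_line (-2, 1) (b - N) (L + N - b) (by linarith) (by linarith) v1 v2
        (by ext <;> simp; ring) (by ext <;> simp; ring)
    have e2 : (-(L + 2 * N), b) ∈ C :=
      hC.mem_of_line (0, 1) (b - N) (L + N - b) (by linarith) (by linarith) v6 v4
        (by ext <;> simp) (by ext <;> simp)
    exact hC.mem_of_line (1, 0) (a + (L + 2 * N)) (L + 2 * N - a - 2 * b) (by linarith)
      (by linarith) e2 e1 (by ext <;> simp) (by ext <;> simp; ring)

theorem weightLE_iff (l m : ℕ) (ν : ℤ × ℤ) :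
    WeightLE ν (DominantWeight.toWeight (l, m)) ↔ InOctagon l m ν := by
  have key {α β c : ℤ} (h : ∀ μ, InOctagon l m μ → α * μ.1 + β * μ.2 ≤ c)
      (hν : toReal ν ∈ convexHull ℝ (toReal '' weylOrbit (DominantWeight.toWeight (l, m)))) :
      α * ν.1 + β * ν.2 ≤ c := by
    have := le_of_mem_convexHull (α := α) (β := β) (c := c) ?_ hν
    · simp only [toReal] at this
      exact_mod_cast this
    · rintro _ ⟨μ, hμ, rfl⟩
      have := h μ (inOctagon_of_mem_weylOrbit hμ)
      simp only [toReal]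
      exact_mod_cast this
  constructor
  · rintro ⟨h, hν⟩
    rw [mem_rootLattice_iff] at h
    refine ⟨by simpa [DominantWeight.toWeight] using h, ?_, ?_, ?_, ?_, ?_, ?_, ?_, ?_⟩
    · linarith [key (α := 1) (β := 0) (c := l + 2 * m) (fun μ hμ => by linarith [hμ.h1]) hν]
    · linarith [key (α := -1) (β := 0) (c := l + 2 * m) (fun μ hμ => by linarith [hμ.h2]) hν]
    · linarith [key (α := 1) (β := 2) (c := l + 2 * m) (fun μ hμ => by linarith [hμ.h3]) hν]
    · linarith [key (α := -1) (β := -2) (c := l + 2 * m) (fun μ hμ => by linarith [hμ.h4]) hν]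
    · linarith [key (α := 0) (β := 1) (c := l + m) (fun μ hμ => by linarith [hμ.h5]) hν]
    · linarith [key (α := 0) (β := -1) (c := l + m) (fun μ hμ => by linarith [hμ.h6]) hν]
    · linarith [key (α := 1) (β := 1) (c := l + m) (fun μ hμ => by linarith [hμ.h7]) hν]
    · linarith [key (α := -1) (β := -1) (c := l + m) (fun μ hμ => by linarith [hμ.h8]) hν]
  · rintro ⟨p, p1, p2, p3, p4, p5, p6, p7, p8⟩
    refine ⟨?_, ?_⟩
    · rw [mem_rootLattice_iff]
      simpa [DominantWeight.toWeight] using p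
    · have hv (is : List Node) : toReal (is.foldr reflectWeight (DominantWeight.toWeight (l, m))) ∈
          convexHull ℝ (toReal '' weylOrbit (DominantWeight.toWeight (l, m))) :=
        subset_convexHull _ _ ⟨_, ⟨is, rfl⟩, rfl⟩
      refine mem_convexHull_of_octagon (convex_convexHull ℝ _) (L := l) (N := m)
        (Nat.cast_nonneg l) (Nat.cast_nonneg m) ?_ ?_ ?_ ?_ ?_ ?_ ?_ ?_ ?_ ?_ ?_ ?_ ?_ ?_ ?_ ?_
      · simpa [toReal, reflectWeight, DominantWeight.toWeight] using hv []
      · convert hv [.n1] using 1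
        ext <;> simp [toReal, reflectWeight, DominantWeight.toWeight] <;> ring
      · convert hv [.n2] using 1
        ext <;> simp [toReal, reflectWeight, DominantWeight.toWeight] <;> ring
      · convert hv [.n1, .n2] using 1
        ext <;> simp [toReal, reflectWeight, DominantWeight.toWeight] <;> ring
      · convert hv [.n2, .n1] using 1
        ext <;> simp [toReal, reflectWeight, DominantWeight.toWeight] <;> ring
      · convert hv [.n1, .n2, .n1] using 1
        ext <;> simp [toReal, reflectWeight, DominantWeight.toWeight] <;> ring
      · convert hv [.n2, .n1, .n2] using 1
        ext <;> simp [toReal, reflectWeight, DominantWeight.toWeight] <;> ring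
      · convert hv [.n1, .n2, .n1, .n2] using 1
        ext <;> simp [toReal, reflectWeight, DominantWeight.toWeight] <;> ring
      all_goals norm_cast

/-! ### Characters of atoms -/

theorem finite_dominant_le (l m : ℕ) :
    {ν : DominantWeight | WeightLE ν.toWeight (DominantWeight.toWeight (l, m))}.Finite := by
  refine (Set.finite_Iic ((l + 2 * m, l + m) : ℕ × ℕ)).subset fun ν hν => ?_
  obtain ⟨-, p1, -, -, -, p5, -, -, -⟩ := (weightLE_iff l m _).1 hν
  simp only [DominantWeight.toWeight] at p1 p5
  exact ⟨by dsimp only; omega, by dsimp only; omega⟩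

theorem specializeOne_atomicBasis (l m : ℕ) :
    specializeOne (atomicBasis (l, m)) =
      ∑ᶠ ν ∈ {ν : DominantWeight | WeightLE ν.toWeight (DominantWeight.toWeight (l, m))},
        Finsupp.single ν (1 : ℤ) := by
  have h (x : SphericalHecke) : specializeOne x = Finsupp.mapRange.addMonoidHom
      (LaurentPolynomial.eval₂ (RingHom.id ℤ) (1 : ℤˣ)).toAddMonoidHom x := rfl
  rw [h, atomicBasis, AddMonoidHom.map_finsum_mem _ _ (finite_dominant_le l m)]
  refine finsum_mem_congr rfl fun ν _ => ?_
  simp [LaurentPolynomial.eval₂_T]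

/-- The character identity is automatic: the weight map is a bijection from the dominant part of `A`
onto the dominant weights below `(l, m)`. -/
theorem isAtom_of_existsUnique {A : Set Tableau} {l m : ℕ}
    (hex : ∀ ν, InOctagon l m ν → ∃! T : Tableau, T ∈ A ∧ T.weight = ν)
    (hA : ∀ T ∈ A, InOctagon l m T.weight) : IsAtom A (l, m) where
  character := by
    rw [specializeOne_atomicBasis, ungradedCharacter]
    refine finsum_mem_eq_of_bijOn
      (fun T : Tableau => ((T.weight.1.toNat, T.weight.2.toNat) : DominantWeight)) ⟨?_, ?_, ?_⟩ ?_
    · rintro T ⟨hT, h1, h2⟩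
      have : DominantWeight.toWeight (T.weight.1.toNat, T.weight.2.toNat) = T.weight := by
        ext <;> simp [DominantWeight.toWeight, h1, h2]
      show WeightLE _ _
      rw [this, weightLE_iff]
      exact hA T hT
    · rintro T ⟨hT, h1, h2⟩ S ⟨hS, k1, k2⟩ e
      simp only [Prod.mk.injEq] at e
      refine (hex _ (hA T hT)).unique ⟨hT, rfl⟩ ⟨hS, ?_⟩
      ext <;> omega
    · intro ν hν
      obtain ⟨T, ⟨hT, hw⟩, -⟩ := hex _ ((weightLE_iff l m _).1 hν)
      refine ⟨T, ⟨hT, ?_, ?_⟩, ?_⟩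
      · rw [hw]; exact Int.natCast_nonneg _
      · rw [hw]; exact Int.natCast_nonneg _
      · simp [hw, DominantWeight.toWeight]
    · intro T _
      rfl
  occursOnce := fun ν hν => hex ν ((weightLE_iff l m ν).1 hν)
  onlyBelow := fun T hT => (weightLE_iff l m _).2 (hA T hT)


open Point

variable {l m : ℕ}

/-! ### The maps `Ψ` and `Ψ̄` on tableaux -/

/-- The points of the principal preatom. -/
abbrev PrimPoint (l m : ℕ) := {P : Point // P.Valid l m ∧ P.Prim}

/-- The tableau of a point of the principal preatom. -/
def ofPoint (P : PrimPoint l m) : preatom l m :=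
  ⟨P.1.tableau, by rw [preatom_eq]; exact ⟨P.1, P.2, rfl⟩⟩

theorem ofPoint_bijective (l m : ℕ) : Function.Bijective (ofPoint (l := l) (m := m)) := by
  constructor
  · intro P P' h
    exact Subtype.ext (tableau_injOn l m P.2.1 P'.2.1 (congrArg Subtype.val h))
  · rintro ⟨T, hT⟩
    obtain ⟨P, hP, rfl⟩ := (preatom_eq l m).subset hT
    exact ⟨⟨P, hP⟩, rfl⟩

/-- Tableaux of the principal preatom and their points. -/
noncomputable def pointEquiv (l m : ℕ) : PrimPoint l m ≃ preatom l m :=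
  Equiv.ofBijective ofPoint (ofPoint_bijective l m)

theorem preatom_subset_crystal (l m : ℕ) : preatom l m ⊆ crystal l m := by
  rw [preatom_eq, crystal_eq]
  exact Set.image_mono fun P hP => hP.1

theorem crystal_eq_of_str2_eq {S T : Tableau} (hS : S ∈ crystal l m) (hT : T ∈ crystal l m)
    (h : S.str2 = T.str2) : S = T := by
  rw [crystal_eq] at hS hT
  obtain ⟨P, hP, rfl⟩ := hS
  obtain ⟨P', hP', rfl⟩ := hT
  rw [eq_of_str2_eq hP hP' h]

theorem preatom_eq_of_str2_eq {S T : preatom l m} (h : S.1.str2 = T.1.str2) : S = T :=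
  Subtype.ext (crystal_eq_of_str2_eq (preatom_subset_crystal l m S.2)
    (preatom_subset_crystal l m T.2) h)

/-- The adapted string depends only on the reading word, and it determines the tableau. -/
theorem preatom_eq_of_isReflection1 {X : Tableau} {S T : preatom l m} (hS : X.IsReflection1 S.1)
    (hT : X.IsReflection1 T.1) : S = T :=
  preatom_eq_of_str2_eq (by rw [Tableau.str2, Tableau.str2, hS.2.2, hT.2.2])

noncomputable def psiMap (l m : ℕ) (T : preatom l m) : preatom l (m + 1) :=
  pointEquiv l (m + 1) ⟨((pointEquiv l m).symm T).1.psi,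
    valid_psi ((pointEquiv l m).symm T).2.1 ((pointEquiv l m).symm T).2.2,
    prim_psi ((pointEquiv l m).symm T).2.1 ((pointEquiv l m).symm T).2.2⟩

noncomputable def psiBarMap : PreatomMaps := fun l m T =>
  pointEquiv l (m + 1) ⟨((pointEquiv l m).symm T).1.psiBar,
    valid_psiBar ((pointEquiv l m).symm T).2.1 ((pointEquiv l m).symm T).2.2,
    prim_psiBar ((pointEquiv l m).symm T).2.1 ((pointEquiv l m).symm T).2.2⟩

theorem psiMap_pointEquiv (P : PrimPoint l m) : psiMap l m (pointEquiv l m P) =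
    pointEquiv l (m + 1) ⟨P.1.psi, valid_psi P.2.1 P.2.2, prim_psi P.2.1 P.2.2⟩ := by
  simp only [psiMap, Equiv.symm_apply_apply]

theorem psiBarMap_pointEquiv (P : PrimPoint l m) : psiBarMap l m (pointEquiv l m P) =
    pointEquiv l (m + 1) ⟨P.1.psiBar, valid_psiBar P.2.1 P.2.2, prim_psiBar P.2.1 P.2.2⟩ := by
  simp only [psiBarMap, Equiv.symm_apply_apply]

theorem val_psiMap (P : PrimPoint l m) :
    (psiMap l m (pointEquiv l m P)).1 = P.1.psi.tableau := by
  rw [psiMap_pointEquiv]; rfl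

theorem val_psiBarMap (P : PrimPoint l m) :
    (psiBarMap l m (pointEquiv l m P)).1 = P.1.psiBar.tableau := by
  rw [psiBarMap_pointEquiv]; rfl

theorem isPsi_psiMap (l m : ℕ) : IsPsi (psiMap l m) := by
  intro T a b c d h
  obtain ⟨P, rfl⟩ := (pointEquiv l m).surjective T
  rw [val_psiMap]
  exact str2_psi P.2.1 P.2.2 a b c d h

theorem IsPsi.eq_psiMap {Ψ : preatom l m → preatom l (m + 1)} (h : IsPsi Ψ) : Ψ = psiMap l m := by
  funext T
  exact preatom_eq_of_str2_eq ((h T _ _ _ _ rfl).trans (isPsi_psiMap l m T _ _ _ _ rfl).symm)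

theorem Point.IsRefl.symm {P P' : Point} (h : P.IsRefl P') : P'.IsRefl P := by
  obtain ⟨h1, h2, h3, h4, h5, h6, h7⟩ := h
  exact ⟨h1.symm, h2.symm, h3.symm, h4.symm, h5.symm, h6.symm, by omega⟩

/-- The image of a point of the preatom under `s₁`. -/
def reflPrim (P : PrimPoint l m) : PrimPoint l m :=
  ⟨P.1.refl, valid_refl P.2.1,
    (isRefl_refl P.2.1).prim P.2.1 (valid_refl P.2.1) P.2.2⟩

theorem isRefl_reflPrim (P : PrimPoint l m) : P.1.IsRefl (reflPrim P).1 := isRefl_refl P.2.1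

theorem weight_pointEquiv (P : PrimPoint l m) : (pointEquiv l m P).1.weight = P.1.weight :=
  weight_tableau P.2.1

theorem psiBarMap_eq_psiMap (T : preatom l m) (h : T.1.weight.1 ≤ 0) :
    psiBarMap l m T = psiMap l m T := by
  obtain ⟨P, rfl⟩ := (pointEquiv l m).surjective T
  rw [weight_pointEquiv] at h
  apply Subtype.ext
  rw [val_psiBarMap, val_psiMap, psiBar_eq_psi P.2.1 P.2.2 h]

theorem isReflection1_psiBarMap {P P' : PrimPoint l m} (h : P.1.IsRefl P'.1) :
    (psiBarMap l m (pointEquiv l m P)).1.IsReflection1 (psiBarMap l m (pointEquiv l m P')).1 := by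
  rw [val_psiBarMap, val_psiBarMap]
  exact isReflection1_tableau (valid_psiBar P.2.1 P.2.2) (valid_psiBar P'.2.1 P'.2.2)
    (h.psiBar P.2.1 P'.2.1 P.2.2)

theorem isPsiBar_psiBarMap (l m : ℕ) : IsPsiBar (psiBarMap l m) := by
  refine ⟨psiMap l m, isPsi_psiMap l m, fun T h => psiBarMap_eq_psiMap T h, fun T h => ?_⟩
  obtain ⟨P, rfl⟩ := (pointEquiv l m).surjective T
  have hr := isRefl_reflPrim P
  refine ⟨pointEquiv l m (reflPrim P),
    isReflection1_tableau P.2.1 (reflPrim P).2.1 hr, ?_⟩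
  rw [← psiBarMap_eq_psiMap]
  · exact isReflection1_psiBarMap hr.symm
  · rw [weight_pointEquiv] at h ⊢
    rw [hr.weight_fst]
    omega

theorem IsPsiBar.eq_psiBarMap {Ψ' : preatom l m → preatom l (m + 1)} (h : IsPsiBar Ψ') :
    Ψ' = psiBarMap l m := by
  obtain ⟨Ψ, hΨ, h1, h2⟩ := h
  obtain ⟨Ψ₀, hΨ₀, k1, k2⟩ := isPsiBar_psiBarMap l m
  obtain rfl := hΨ.eq_psiMap.trans hΨ₀.eq_psiMap.symm
  funext T
  rcases le_total T.1.weight.1 0 with hT | hT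
  · rw [h1 T hT, k1 T hT]
  · obtain ⟨S, hS, hS'⟩ := h2 T hT
    obtain ⟨S₀, hS₀, hS₀'⟩ := k2 T hT
    obtain rfl := preatom_eq_of_isReflection1 hS hS₀
    exact preatom_eq_of_isReflection1 hS' hS₀'

theorem psiBarMap_injective (l m : ℕ) : Function.Injective (psiBarMap l m) := by
  intro T T' h
  obtain ⟨P, rfl⟩ := (pointEquiv l m).surjective T
  obtain ⟨P', rfl⟩ := (pointEquiv l m).surjective T'
  rw [psiBarMap_pointEquiv, psiBarMap_pointEquiv] at h
  have h' := congrArg Subtype.val ((pointEquiv l (m + 1)).injective h)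
  exact congrArg _ (Subtype.ext (psiBar_injOn l m P.2 P'.2 h'))

theorem weight_psiBarMap (T : preatom l m) : (psiBarMap l m T).1.weight = T.1.weight := by
  obtain ⟨P, rfl⟩ := (pointEquiv l m).surjective T
  rw [psiBarMap_pointEquiv, weight_pointEquiv, weight_pointEquiv]
  exact weight_psiBar P.2.1 P.2.2

theorem exists_isReflection1 (T : preatom l m) : ∃ S : preatom l m,
    T.1.IsReflection1 S.1 ∧ (psiBarMap l m T).1.IsReflection1 (psiBarMap l m S).1 := by
  obtain ⟨P, rfl⟩ := (pointEquiv l m).surjective T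
  have hr := isRefl_reflPrim P
  exact ⟨pointEquiv l m (reflPrim P), isReflection1_tableau P.2.1 (reflPrim P).2.1 hr,
    isReflection1_psiBarMap hr⟩

/-! ### The atoms -/

theorem inOctagon_weight_of_mem_crystal {T : Tableau} (hT : T ∈ crystal l m) :
    InOctagon l m T.weight := by
  rw [crystal_eq] at hT
  obtain ⟨P, hP, rfl⟩ := hT
  rw [weight_tableau hP]
  exact inOctagon_weight hP

theorem isAtom_image_val {A : Set (preatom l m)} {p : PrimPoint l m → Prop}
    (hA : ∀ P, pointEquiv l m P ∈ A ↔ p P)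
    (hex : ∀ ν, InOctagon l m ν → ∃ P, p P ∧ P.1.weight = ν)
    (huniq : ∀ P P', p P → p P' → P.1.weight = P'.1.weight → P.1 = P'.1) :
    IsAtom (Subtype.val '' A) (l, m) := by
  refine isAtom_of_existsUnique (fun ν hν => ?_) ?_
  · obtain ⟨P, hP, rfl⟩ := hex ν hν
    refine ⟨(pointEquiv l m P).1, ⟨⟨_, (hA P).2 hP, rfl⟩, weight_pointEquiv P⟩, ?_⟩
    rintro _ ⟨⟨T, hT, rfl⟩, hw⟩
    obtain ⟨P', rfl⟩ := (pointEquiv l m).surjective T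
    rw [weight_pointEquiv] at hw
    exact congrArg Point.tableau (huniq _ _ ((hA P').1 hT) hP hw)
  · rintro _ ⟨T, -, rfl⟩
    exact inOctagon_weight_of_mem_crystal (preatom_subset_crystal l m T.2)

theorem mem_compl_range_psiBarMap_iff (hl : l ≠ 0) (P : PrimPoint l (m + 1)) :
    pointEquiv l (m + 1) P ∈ (Set.range (psiBarMap l m))ᶜ ↔ P.1.Atomic := by
  constructor
  · intro h
    by_contra ha
    obtain ⟨P', h1, h2, h3⟩ := exists_psiBar_eq hl P.2.1 P.2.2 ha
    refine h ⟨pointEquiv l m ⟨P', h1, h2⟩, ?_⟩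
    rw [psiBarMap_pointEquiv]
    exact congrArg _ (Subtype.ext h3)
  · rintro ha ⟨T, hT⟩
    obtain ⟨P', rfl⟩ := (pointEquiv l m).surjective T
    rw [psiBarMap_pointEquiv] at hT
    have := congrArg Subtype.val ((pointEquiv l (m + 1)).injective hT)
    dsimp only at this
    rw [← this] at ha
    exact not_atomic_psiBar hl P'.2.1 P'.2.2 ha

theorem isAtom_compl_range (hl : l ≠ 0) :
    IsAtom (Subtype.val '' (Set.range (psiBarMap l m))ᶜ) (l, m + 1) := by
  refine isAtom_image_val (mem_compl_range_psiBarMap_iff hl) (fun ν hν => ?_)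
    fun P P' h h' hw => h.eq_of_weight_eq P.2.1 P'.2.1 h' hw
  obtain ⟨P, h1, h2, h3, h4⟩ := exists_atomic hl (Nat.succ_pos m) hν
  exact ⟨⟨P, h1, h2⟩, h3, h4⟩

theorem mem_compl_range_psiBarMap_comp_iff (P : PrimPoint 0 (m + 2)) :
    pointEquiv 0 (m + 2) P ∈ (Set.range (psiBarMap 0 (m + 1) ∘ psiBarMap 0 m))ᶜ ↔
      P.1.Atomic₀ := by
  rw [atomic₀_iff P.2.1, Set.mem_compl_iff, not_iff_not]
  constructor
  · rintro ⟨T, hT⟩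
    obtain ⟨P', rfl⟩ := (pointEquiv 0 m).surjective T
    rw [Function.comp_apply, psiBarMap_pointEquiv, psiBarMap_pointEquiv] at hT
    exact ⟨P'.1, P'.2.1, congrArg Subtype.val ((pointEquiv 0 (m + 2)).injective hT)⟩
  · rintro ⟨P', h1, h2⟩
    refine ⟨pointEquiv 0 m ⟨P', h1, prim_zero h1⟩, ?_⟩
    rw [Function.comp_apply, psiBarMap_pointEquiv, psiBarMap_pointEquiv]
    exact congrArg _ (Subtype.ext h2)

theorem isAtom_compl_range_comp :
    IsAtom (Subtype.val '' (Set.range (psiBarMap 0 (m + 1) ∘ psiBarMap 0 m))ᶜ) (0, m + 2) := by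
  refine isAtom_image_val mem_compl_range_psiBarMap_comp_iff (fun ν hν => ?_)
    fun P P' h h' hw => h.eq_of_weight_eq P.2.1 P'.2.1 h' hw
  obtain ⟨P, h1, h2, h3⟩ := exists_atomic₀ hν
  exact ⟨⟨P, h1, prim_zero h1⟩, h2, h3⟩

theorem principalAtom_succ_succ (Ψbar : PreatomMaps) (l m : ℕ) :
    principalAtom Ψbar (l + 1) (m + 1) = (Set.range (Ψbar (l + 1) m))ᶜ := by
  cases m <;> rfl

theorem isAtom_principalAtom (l m : ℕ) :
    IsAtom (Subtype.val '' principalAtom psiBarMap l m) (l, m) := by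
  match l, m with
  | l, 0 =>
    have e : principalAtom psiBarMap l 0 = Set.univ := by cases l <;> rfl
    rw [e]
    refine isAtom_image_val (p := fun _ => True) (fun _ => by simp) (fun ν hν => ?_)
      fun P P' _ _ hw => eq_of_weight_eq_zero P.2.1 P'.2.1 P.2.2 P'.2.2 hw
    obtain ⟨P, h1, h2, h3⟩ := exists_valid_zero hν
    exact ⟨⟨P, h1, h2⟩, trivial, h3⟩
  | 0, 1 =>
    refine isAtom_image_val (p := fun _ => True) (fun _ => by simp [principalAtom])
      (fun ν hν => ?_) fun P P' _ _ hw => eq_of_weight_eq_zero_one P.2.1 P'.2.1 hw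
    obtain ⟨P, h1, h2⟩ := exists_valid_zero_one hν
    exact ⟨⟨P, h1, prim_zero h1⟩, trivial, h2⟩
  | 0, m + 2 => exact isAtom_compl_range_comp
  | l + 1, m + 1 =>
    rw [principalAtom_succ_succ]
    exact isAtom_compl_range (Nat.succ_ne_zero l)

/-! ### The atomic decomposition -/

theorem Phi_mem_crystal {T : Tableau} (hT : T ∈ crystal l m) : T.Phi ∈ crystal (l + 2) m := by
  rw [crystal_eq] at hT ⊢
  obtain ⟨P, hP, rfl⟩ := hT
  exact ⟨P.phi, valid_phi hP, (Phi_tableau hP).symm⟩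

theorem Phi_injOn (l m : ℕ) : Set.InjOn Tableau.Phi (crystal l m) := by
  rw [crystal_eq]
  rintro _ ⟨P, hP, rfl⟩ _ ⟨P', hP', rfl⟩ h
  rw [Phi_tableau hP, Phi_tableau hP'] at h
  rw [phi_injOn l m hP hP' (tableau_injOn (l + 2) m (valid_phi hP) (valid_phi hP') h)]

theorem weight_Phi {T : Tableau} (hT : T ∈ crystal l m) : T.Phi.weight = T.weight := by
  rw [crystal_eq] at hT
  obtain ⟨P, hP, rfl⟩ := hT
  rw [Phi_tableau hP, weight_tableau (valid_phi hP), weight_tableau hP, weight_phi]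

theorem iterate_Phi_mem_crystal {T : Tableau} (hT : T ∈ crystal l m) (k : ℕ) :
    Tableau.Phi^[k] T ∈ crystal (l + 2 * k) m := by
  induction k with
  | zero => exact hT
  | succ k ih =>
    rw [Function.iterate_succ_apply']
    exact Phi_mem_crystal ih

theorem weight_iterate_Phi {T : Tableau} (hT : T ∈ crystal l m) (k : ℕ) :
    (Tableau.Phi^[k] T).weight = T.weight := by
  induction k with
  | zero => rfl
  | succ k ih => rw [Function.iterate_succ_apply', weight_Phi (iterate_Phi_mem_crystal hT k), ih]

theorem weight_iteratePsi (T : preatom l m) (j : ℕ) :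
    (iteratePsi psiBarMap l m j T).1.weight = T.1.weight := by
  induction j with
  | zero => rfl
  | succ j ih => rw [iteratePsi, weight_psiBarMap, ih]

theorem isAtom_atomPiece (p : ℕ × ℕ × ℕ × ℕ) : IsAtom (atomPiece psiBarMap p) (p.1, p.2.1) := by
  obtain ⟨l, m, k, j⟩ := p
  have h := isAtom_principalAtom l m
  have hw (T : preatom l m) :
      (Tableau.Phi^[k] (iteratePsi psiBarMap l m j T).1).weight = T.1.weight := by
    rw [weight_iterate_Phi (preatom_subset_crystal _ _ (Subtype.property _)), weight_iteratePsi]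
  refine isAtom_of_existsUnique (fun ν hν => ?_) ?_
  · obtain ⟨_, ⟨⟨T, hT, rfl⟩, hTν⟩, huniq⟩ := h.occursOnce ν ((weightLE_iff l m ν).2 hν)
    refine ⟨_, ⟨⟨T, hT, rfl⟩, (hw T).trans hTν⟩, ?_⟩
    rintro _ ⟨⟨S, hS, rfl⟩, hSν⟩
    have := huniq S.1 ⟨⟨S, hS, rfl⟩, (hw S).symm.trans hSν⟩
    rw [Subtype.ext this]
  · rintro _ ⟨T, hT, rfl⟩
    show InOctagon l m (Tableau.weight _)
    rw [hw T]
    exact inOctagon_weight_of_mem_crystal (preatom_subset_crystal l m T.2)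

/-- Descent on `m`: outside the principal atom one may remove `Ψ̄`, or `Ψ̄²` if `l = 0`, which keeps
`j` even. -/
theorem exists_iteratePsi_eq (l m : ℕ) (T : preatom l m) : ∃ (m' j : ℕ) (S : preatom l m'),
    S ∈ principalAtom psiBarMap l m' ∧ m' + j = m ∧ (l = 0 → Even j) ∧
      (iteratePsi psiBarMap l m' j S).1 = T.1 := by
  induction m using Nat.strong_induction_on with
  | _ m ih =>
    by_cases hT : T ∈ principalAtom psiBarMap l m
    · exact ⟨m, 0, T, hT, rfl, fun _ => Even.zero, rfl⟩
    match l, m with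
    | l, 0 => exact absurd (by cases l <;> trivial) hT
    | 0, 1 => exact absurd trivial hT
    | 0, m + 2 =>
      obtain ⟨T', rfl⟩ := not_not.1 hT
      obtain ⟨m', j, S, hS, rfl, hj, e⟩ := ih m (by omega) T'
      refine ⟨m', j + 2, S, hS, rfl, fun h => (hj h).add even_two, ?_⟩
      rw [Subtype.ext e.symm]
      rfl
    | l + 1, m + 1 =>
      rw [principalAtom_succ_succ] at hT
      obtain ⟨T', rfl⟩ := not_not.1 hT
      obtain ⟨m', j, S, hS, rfl, -, e⟩ := ih m (by omega) T'
      refine ⟨m', j + 1, S, hS, rfl, fun h => absurd h (Nat.succ_ne_zero l), ?_⟩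
      rw [Subtype.ext e.symm]
      rfl

theorem exists_mem_atomPiece (l m : ℕ) {T : Tableau} (hT : T ∈ crystal l m) :
    ∃ p ∈ atomIndex l m, T ∈ atomPiece psiBarMap p := by
  induction l using Nat.strong_induction_on generalizing T with
  | _ l ih =>
    by_cases hP : T ∈ preatom l m
    · obtain ⟨m', j, S, hS, hm, hj, e⟩ := exists_iteratePsi_eq l m ⟨T, hP⟩
      exact ⟨(l, m', 0, j), ⟨rfl, hm, hj⟩, S, hS, e⟩
    · match l with
      | 0 => exact absurd hT hP
      | 1 => exact absurd hT hP
      | l + 2 =>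
        have : T ∈ Tableau.Phi '' crystal l m := by
          by_contra h
          exact hP ⟨hT, h⟩
        obtain ⟨T', hT', rfl⟩ := this
        obtain ⟨⟨l', m', k, j⟩, ⟨h1, h2, h3⟩, S, hS, rfl⟩ := ih l (by omega) hT'
        refine ⟨(l', m', k + 1, j), ⟨?_, h2, h3⟩, S, hS, Function.iterate_succ_apply' _ _ _⟩
        dsimp only at h1 ⊢
        omega

/-- Injectivity removes `Φ` from both sides; when only one side is exhausted, a preatom element
would lie in the image of `Φ`. -/
theorem eq_of_iterate_Phi_eq {l l' k k' : ℕ} {T T' : Tableau} (hT : T ∈ preatom l m)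
    (hT' : T' ∈ preatom l' m) (hl : l + 2 * k = l' + 2 * k')
    (h : Tableau.Phi^[k] T = Tableau.Phi^[k'] T') : k = k' ∧ T = T' := by
  induction k generalizing k' with
  | zero =>
    cases k' with
    | zero => exact ⟨rfl, h⟩
    | succ k' =>
      obtain rfl : l = (l' + 2 * k') + 2 := by omega
      rw [Function.iterate_succ_apply'] at h
      exact absurd ⟨_, iterate_Phi_mem_crystal (preatom_subset_crystal _ _ hT') k', h.symm⟩ hT.2
  | succ k ih =>
    cases k' with
    | zero =>
      obtain rfl : l' = (l + 2 * k) + 2 := by omega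
      rw [Function.iterate_succ_apply'] at h
      exact absurd ⟨_, iterate_Phi_mem_crystal (preatom_subset_crystal _ _ hT) k, h⟩ hT'.2
    | succ k' =>
      rw [Function.iterate_succ_apply', Function.iterate_succ_apply'] at h
      have e : l + 2 * k = l' + 2 * k' := by omega
      have := ih e (Phi_injOn (l + 2 * k) m
        (iterate_Phi_mem_crystal (preatom_subset_crystal _ _ hT) k)
        (e ▸ iterate_Phi_mem_crystal (preatom_subset_crystal _ _ hT') k') h)
      exact ⟨by rw [this.1], this.2⟩

/-- When powers of `Ψ̄` are removed, the two ranks agree only propositionally, so equalities are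
stated between underlying tableaux. -/
theorem val_eq_of_val_psiBarMap_eq {a b : ℕ} (hab : a = b) {S : preatom l a} {S' : preatom l b}
    (h : (psiBarMap l a S).1 = (psiBarMap l b S').1) : S.1 = S'.1 := by
  subst hab
  rw [psiBarMap_injective l a (Subtype.ext h)]

theorem val_ne_val_psiBarMap (hl : l ≠ 0) {a b : ℕ} (hab : a = b + 1) {S : preatom l a}
    (hS : S ∈ principalAtom psiBarMap l a) (S' : preatom l b) : S.1 ≠ (psiBarMap l b S').1 := by
  subst hab
  intro h
  obtain ⟨l, rfl⟩ := Nat.exists_eq_add_one_of_ne_zero hl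
  rw [principalAtom_succ_succ] at hS
  exact hS ⟨S', Subtype.ext h.symm⟩

theorem val_ne_val_psiBarMap_psiBarMap {a b : ℕ} (hab : a = b + 2) {S : preatom 0 a}
    (hS : S ∈ principalAtom psiBarMap 0 a) (S' : preatom 0 b) :
    S.1 ≠ (psiBarMap 0 (b + 1) (psiBarMap 0 b S')).1 := by
  subst hab
  intro h
  exact hS ⟨S', Subtype.ext h.symm⟩

theorem eq_of_iteratePsi_eq (hl : l ≠ 0) {m m' j j' : ℕ} {S : preatom l m} {S' : preatom l m'}
    (hS : S ∈ principalAtom psiBarMap l m) (hS' : S' ∈ principalAtom psiBarMap l m')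
    (hm : m + j = m' + j')
    (h : (iteratePsi psiBarMap l m j S).1 = (iteratePsi psiBarMap l m' j' S').1) : j = j' := by
  induction j generalizing j' with
  | zero =>
    cases j' with
    | zero => rfl
    | succ j' => exact absurd h (val_ne_val_psiBarMap hl hm hS _)
  | succ j ih =>
    cases j' with
    | zero => exact absurd h.symm (val_ne_val_psiBarMap hl hm.symm hS' _)
    | succ j' =>
      have e : m + j = m' + j' := by omega
      rw [ih e (val_eq_of_val_psiBarMap_eq e h)]

/-- For `l = 0` the principal atom avoids only the image of `Ψ̄²`, so the powers are removed in
pairs. -/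
theorem eq_of_iteratePsi_zero_eq {m m' j j' : ℕ} {S : preatom 0 m} {S' : preatom 0 m'}
    (hS : S ∈ principalAtom psiBarMap 0 m) (hS' : S' ∈ principalAtom psiBarMap 0 m')
    (hm : m + 2 * j = m' + 2 * j')
    (h : (iteratePsi psiBarMap 0 m (2 * j) S).1 = (iteratePsi psiBarMap 0 m' (2 * j') S').1) :
    j = j' := by
  induction j generalizing j' with
  | zero =>
    cases j' with
    | zero => rfl
    | succ j' => exact absurd h (val_ne_val_psiBarMap_psiBarMap hm hS _)
  | succ j ih =>
    cases j' with
    | zero => exact absurd h.symm (val_ne_val_psiBarMap_psiBarMap hm.symm hS' _)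
    | succ j' =>
      have e : m + 2 * j = m' + 2 * j' := by omega
      have e' : m + (2 * j + 1) = m' + (2 * j' + 1) := by omega
      rw [ih e (val_eq_of_val_psiBarMap_eq e (val_eq_of_val_psiBarMap_eq e' h))]

theorem pairwiseDisjoint_atomPiece (l m : ℕ) :
    (atomIndex l m).PairwiseDisjoint (atomPiece psiBarMap) := by
  rintro ⟨l₁, m₁, k₁, j₁⟩ ⟨h1, h2, h3⟩ ⟨l₂, m₂, k₂, j₂⟩ ⟨g1, g2, g3⟩ hne
  dsimp only at *
  refine Set.disjoint_left.2 ?_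
  rintro _ ⟨S, hS, rfl⟩ ⟨S', hS', h⟩
  dsimp only at *
  subst g2
  have hmem : (iteratePsi psiBarMap l₁ m₁ j₁ S).1 ∈ preatom l₁ (m₂ + j₂) := by
    rw [← h2]
    exact Subtype.property _
  obtain ⟨rfl, e⟩ := eq_of_iterate_Phi_eq (Subtype.property _) hmem (by omega) h
  obtain rfl : l₁ = l₂ := by omega
  refine hne ?_
  rcases Nat.eq_zero_or_pos l₁ with rfl | hl
  · obtain ⟨i, rfl⟩ := (even_iff_exists_two_mul.1 (h3 rfl))
    obtain ⟨i', rfl⟩ := (even_iff_exists_two_mul.1 (g3 rfl))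
    obtain rfl := eq_of_iteratePsi_zero_eq hS hS' h2 e.symm
    obtain rfl : m₁ = m₂ := by omega
    rfl
  · obtain rfl := eq_of_iteratePsi_eq hl.ne' hS hS' h2 e.symm
    obtain rfl : m₁ = m₂ := by omega
    rfl

theorem crystal_eq_iUnion (l m : ℕ) :
    crystal l m = ⋃ p ∈ atomIndex l m, atomPiece psiBarMap p := by
  ext T
  simp only [Set.mem_iUnion, exists_prop]
  constructor
  · exact exists_mem_atomPiece l m
  · rintro ⟨⟨l', m', k, j⟩, ⟨rfl, rfl, -⟩, S, -, rfl⟩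
    exact iterate_Phi_mem_crystal (preatom_subset_crystal _ _ (Subtype.property _)) k

end C2Crystal

theorem mainTheorem4 :
    ∃ Ψbar : C2Crystal.PreatomMaps,
      (∀ l m : ℕ,
        -- `Ψbar` is the map defined on adapted strings and symmetrised along `s₁`
        C2Crystal.IsPsiBar (Ψbar l m) ∧
        (∀ Ψ' : C2Crystal.preatom l m → C2Crystal.preatom l (m + 1),
          C2Crystal.IsPsiBar Ψ' → Ψ' = Ψbar l m) ∧
        -- it is injective and weight-preserving, and commutes with `s₁`
        Function.Injective (Ψbar l m) ∧
        (∀ T : C2Crystal.preatom l m, (Ψbar l m T).1.weight = T.1.weight) ∧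
        (∀ T : C2Crystal.preatom l m, ∃ S : C2Crystal.preatom l m,
          T.1.IsReflection1 S.1 ∧ (Ψbar l m T).1.IsReflection1 (Ψbar l m S).1)) ∧
      -- the complements are atoms
      (∀ l m : ℕ, l ≠ 0 →
        C2Crystal.IsAtom (Subtype.val '' (Set.range (Ψbar l m))ᶜ) (l, m + 1)) ∧
      (∀ m : ℕ,
        C2Crystal.IsAtom
          (Subtype.val '' (Set.range (Ψbar 0 (m + 1) ∘ Ψbar 0 m))ᶜ) (0, m + 2)) ∧
      (∀ l m : ℕ,
        C2Crystal.IsAtom (Subtype.val '' C2Crystal.principalAtom Ψbar l m) (l, m)) ∧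
      -- atomic decomposition of `B(l ϖ₁ + m ϖ₂)`
      (∀ l m : ℕ,
        (C2Crystal.crystal l m =
          ⋃ p ∈ C2Crystal.atomIndex l m, C2Crystal.atomPiece Ψbar p) ∧
        (C2Crystal.atomIndex l m).PairwiseDisjoint (C2Crystal.atomPiece Ψbar) ∧
        (∀ p ∈ C2Crystal.atomIndex l m,
          C2Crystal.IsAtom (C2Crystal.atomPiece Ψbar p) (p.1, p.2.1))) :=
  ⟨C2Crystal.psiBarMap,
    fun l m => ⟨C2Crystal.isPsiBar_psiBarMap l m, fun _ h => h.eq_psiBarMap,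
      C2Crystal.psiBarMap_injective l m, C2Crystal.weight_psiBarMap,
      C2Crystal.exists_isReflection1⟩,
    fun _ _ hl => C2Crystal.isAtom_compl_range hl,
    fun _ => C2Crystal.isAtom_compl_range_comp,
    C2Crystal.isAtom_principalAtom,
    fun l m => ⟨C2Crystal.crystal_eq_iUnion l m, C2Crystal.pairwiseDisjoint_atomPiece l m,
      fun p _ => C2Crystal.isAtom_atomPiece p⟩⟩
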